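/- **Theorem 1.2.** Let $k$ be an algebraically closed field of characteristic $p>0$, let $q=p^e$ with $e\ge 1$, and let $n\ge 1$. For a nonzero matrix $A=(a_{ij})_{0\le i,j\le n}\in M_{n+1}(k)$ let $X_A\subset\mathbb P^n$ be the hypersurface of degree $q+1$ with equation $\sum_{i,j}a_{ij}x_ix_j^q=0$. For $0\le s\le n$ let $X_s=X_{W_s}$, where $$W_s=\begin{pmatrix} I_s & 0\\ 0 & E_{n-s+1}\end{pmatrix},$$ $I_s$ is the $s\times s$ identity matrix and $E_r$ is the $r\times r$ matrix with entries $1$ directly below the diagonal and $0$ elsewhere (so $E_1=(0)$). Two hypersurfaces in $\mathbb P^n$ are called projectively isomorphic if some projective linear transformation in $PGL_{n+1}(k)$ carries one onto the other. Then every $W_s$ has rank $n$, and: 1. if $A$ has rank $n$, then $X_A$ is projectively isomorphic to $X_s$ for exactly one $s\in\{0,\dots,n\}$; 2. if $s\ne s'$, then $X_s$ and $X_{s'}$ are not projectively isomorphic; 3. consequently the hypersurfaces $X_A$ with $\operatorname{rank}A=n$ form exactly $n+1$ projective isomorphism classes. All of this holds both when hypersurfaces are regarded as closed subschemes of $\mathbb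 P^n$ (given by the principal homogeneous ideal of the equation) and when they are regarded as sets of $k$-points. -/

import Mathlib

open scoped LinearAlgebra.Projectivization

noncomputable section

namespace QForm

variable {k : Type*} [Field k] {n : ℕ}

/-- The form `∑ a_ij x_i x_j ^ q` in the homogeneous coordinates `x_0, …, x_n`. -/
def form (q : ℕ) (A : Matrix (Fin (n + 1)) (Fin (n + 1)) k) : MvPolynomial (Fin (n + 1)) k :=
  ∑ i, ∑ j, MvPolynomial.C (A i j) * MvPolynomial.X i * MvPolynomial.X j ^ q

/-- The homogeneous ideal of the hypersurface `X_A` as a closed subscheme of `ℙ^n`, that is, the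
principal ideal generated by its equation. For `n ≥ 1` a principal ideal generated by a nonzero form
is saturated, so that it is determined by the closed subscheme and determines it. -/
def hypersurfaceIdeal (q : ℕ) (A : Matrix (Fin (n + 1)) (Fin (n + 1)) k) :
    Ideal (MvPolynomial (Fin (n + 1)) k) :=
  Ideal.span {form q A}

/-- The set of `k`-points of the hypersurface `X_A` in `ℙ^n`. -/
def hypersurfacePoints (q : ℕ) (A : Matrix (Fin (n + 1)) (Fin (n + 1)) k) :
    Set (ℙ k (Fin (n + 1) → k)) :=
  {P | ∑ i, ∑ j, A i j * P.rep i * P.rep j ^ q = 0}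

/-- The condition that defines `hypersurfacePoints` does not depend on the representative. -/
theorem mk_mem_hypersurfacePoints (q : ℕ) (A : Matrix (Fin (n + 1)) (Fin (n + 1)) k)
    (v : Fin (n + 1) → k) (hv : v ≠ 0) :
    Projectivization.mk k v hv ∈ hypersurfacePoints q A ↔
      ∑ i, ∑ j, A i j * v i * v j ^ q = 0 := by
  obtain ⟨a, ha⟩ := Projectivization.exists_smul_eq_mk_rep k v hv
  have key : ∑ i, ∑ j, A i j * (a • v) i * (a • v) j ^ q
      = (a : k) ^ (q + 1) * ∑ i, ∑ j, A i j * v i * v j ^ q := by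
    simp only [Finset.mul_sum]
    refine Finset.sum_congr rfl fun i _ => Finset.sum_congr rfl fun j _ => ?_
    simp only [Pi.smul_apply, Units.smul_def, smul_eq_mul]
    ring
  change (∑ i, ∑ j, A i j * (Projectivization.mk k v hv).rep i *
    (Projectivization.mk k v hv).rep j ^ q = 0) ↔ _
  rw [← ha, key]
  simp

/-- The linear change of coordinates `x_i ↦ ∑ j, t_ij x_j` on polynomials. -/
def changeCoords (T : Matrix (Fin (n + 1)) (Fin (n + 1)) k) :
    MvPolynomial (Fin (n + 1)) k →ₐ[k] MvPolynomial (Fin (n + 1)) k :=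
  MvPolynomial.aeval fun i => ∑ j, MvPolynomial.C (T i j) * MvPolynomial.X j

/-- Projective isomorphism of closed subschemes of `ℙ^n`, given by their homogeneous ideals:
some invertible linear change of coordinates carries one ideal onto the other. -/
def SchemeProjIso (I J : Ideal (MvPolynomial (Fin (n + 1)) k)) : Prop :=
  ∃ T : GL (Fin (n + 1)) k,
    I.map (changeCoords (T : Matrix (Fin (n + 1)) (Fin (n + 1)) k)) = J

/-- Projective isomorphism of subsets of `ℙ^n`: some projective linear transformation carries
one set onto the other. -/
def PointProjIso (X Y : Set (ℙ k (Fin (n + 1) → k))) : Prop :=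
  ∃ g : (Fin (n + 1) → k) ≃ₗ[k] (Fin (n + 1) → k),
    Projectivization.map g.toLinearMap g.injective '' X = Y

/-- The `r × r` matrix `E_r` with ones directly below the diagonal and zeros elsewhere. -/
def lowerShift (k : Type*) [Field k] (r : ℕ) : Matrix (Fin r) (Fin r) k :=
  Matrix.of fun i j => if (i : ℕ) = j + 1 then 1 else 0

/-- The block diagonal matrix `W_s = diag(I_s, E_{n-s+1})` of size `n + 1`, for `0 ≤ s ≤ n`. -/
def W (k : Type*) [Field k] (n : ℕ) (s : Fin (n + 1)) :
    Matrix (Fin (n + 1)) (Fin (n + 1)) k :=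
  Matrix.reindex
    (finSumFinEquiv.trans (finCongr (Nat.add_sub_cancel' s.is_lt.le)))
    (finSumFinEquiv.trans (finCongr (Nat.add_sub_cancel' s.is_lt.le)))
    (Matrix.fromBlocks (1 : Matrix (Fin (s : ℕ)) (Fin (s : ℕ)) k) 0 0
      (lowerShift k (n + 1 - (s : ℕ))))

end QForm

end

/-! The substitution x ↦ T x replaces A by Tᵀ A T^(q), where T^(q) has the q-th powers of the
entries of T (`qCongr`). The problem is thus to classify q-sesquilinear forms b, linear on the left
and q-semilinear on the right, whose right radical is a line.

Normal form. If b is nondegenerate, the vectors v with b(v, y) = b(y, v)^q for all y are spanned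
for, as in Lang's theorem, by the fixed vectors of an injective q²-semilinear map
(`span_fixed_eq_top`, `span_hermitian_eq_top`). One of them is not isotropic, and splitting it off
repeatedly gives an orthonormal basis. If ρ spans the right radical and is also left orthogonal to
everything, it splits off as a block E_1. Otherwise some z has b(ρ, z) ≠ 0; on a complement of ⟨z,
ρ⟩ the right radical again has dimension at most one, and putting z and ρ back lengthens the block
E_r by two (`IsAdapted.extend`).

Uniqueness. Iterating right orthogonals from the whole space V gives an invariant chain V, V^⊥,
(V^⊥)^⊥, …. For W_s its m-th term contains the left radical exactly when min(m, n - s) is even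
(`leftRadicalLE_W_iff`), and these parities determine s.

Geometry. Equal principal ideals have proportional generators, and a scalar substitution absorbs the
constant (`schemeProjIso_iff`). For point sets, the partial derivatives of the equation are q-th
powers of linear forms, so the equation is squarefree when A has rank at least 2
(`squarefree_form`), and the Nullstellensatz recovers it from its zeros. The remaining case n = 1 is
settled by hand: one model has two points, the other only one. -/

noncomputable section

namespace QForm

/-! ### Fixed vectors of Frobenius-semilinear maps -/

section Semilinear

variable {k : Type*} [Field k]

/-- The polynomials that express the coordinates of a fixed vector through its last coordinate. -/
def coordPoly (Q : ℕ) (a : ℕ → k) : ℕ → Polynomial k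
  | 0 => Polynomial.C (a 0) * Polynomial.X ^ Q
  | i + 1 => coordPoly Q a i ^ Q + Polynomial.C (a (i + 1)) * Polynomial.X ^ Q

/-- The Q-th power of the preceding polynomial dominates the added term. The degree serves to show
that `coordPoly` is not zero. -/
theorem natDegree_coordPoly {Q : ℕ} (hQ : 1 < Q) {a : ℕ → k} (ha : a 0 ≠ 0) (i : ℕ) :
    (coordPoly Q a i).natDegree = Q ^ (i + 1) := by
  induction i with
  | zero => simp [coordPoly, ha]
  | succ i ih =>
    have h1 : (coordPoly Q a i ^ Q).natDegree = Q ^ (i + 1 + 1) := by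
      rw [Polynomial.natDegree_pow, ih]; ring
    rw [coordPoly, Polynomial.natDegree_add_eq_left_of_natDegree_lt, h1]
    rw [h1]
    refine (Polynomial.natDegree_C_mul_X_pow_le _ _).trans_lt ?_
    calc Q = Q ^ 1 := (pow_one Q).symm
      _ < Q ^ (i + 1 + 1) := Nat.pow_lt_pow_right hQ (by omega)

theorem X_pow_dvd_coordPoly {Q : ℕ} (hQ : 1 < Q) (a : ℕ → k) (i : ℕ) :
    Polynomial.X ^ Q ∣ coordPoly Q a i := by
  induction i with
  | zero => exact dvd_mul_left _ _
  | succ i ih => exact dvd_add (dvd_pow ih (by omega)) (dvd_mul_left _ _)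

variable [IsAlgClosed k] (p : ℕ) [Fact p.Prime] [CharP k p]

theorem iterateFrobenius_surjective (f : ℕ) : Function.Surjective (iterateFrobenius k p f) := by
  intro x
  obtain ⟨y, hy⟩ := IsAlgClosed.exists_pow_nat_eq x (n := p ^ f) (pow_pos (Fact.out : p.Prime).pos f)
  exact ⟨y, by rw [iterateFrobenius_def, hy]⟩

/-- Dividing P(t) = t by t, with P = X^Q g, leaves t^(Q-1) g(t) = 1. The left side has positive
degree, so a root exists, and it cannot be 0. -/
theorem exists_eval_coordPoly_eq_self {Q : ℕ} (hQ : 1 < Q) {a : ℕ → k} (ha : a 0 ≠ 0) (i : ℕ) :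
    ∃ t : k, t ≠ 0 ∧ (coordPoly Q a i).eval t = t := by
  obtain ⟨g, hg⟩ := X_pow_dvd_coordPoly hQ a i
  have hne : coordPoly Q a i ≠ 0 := by
    intro h
    have := natDegree_coordPoly hQ ha i
    rw [h, Polynomial.natDegree_zero] at this
    exact (pow_pos (by omega : 0 < Q) _).ne this
  have hg0 : g ≠ 0 := by rintro rfl; exact hne (by simpa using hg)
  have hdeg : (Polynomial.X ^ (Q - 1) * g - 1 : Polynomial k).degree ≠ 0 := by
    have h0 : (0 : WithBot ℕ) < (Polynomial.X ^ (Q - 1) * g : Polynomial k).degree := by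
      rw [← Polynomial.natDegree_pos_iff_degree_pos,
        Polynomial.natDegree_mul (pow_ne_zero _ Polynomial.X_ne_zero) hg0,
        Polynomial.natDegree_X_pow]
      omega
    rw [Polynomial.degree_sub_eq_left_of_degree_lt (by rwa [Polynomial.degree_one])]
    exact h0.ne'
  obtain ⟨t, ht⟩ := IsAlgClosed.exists_root _ hdeg
  have ht' : t ^ (Q - 1) * g.eval t = 1 := by
    have := ht; simp [Polynomial.IsRoot.def, sub_eq_zero] at this; exact this
  refine ⟨t, ?_, ?_⟩
  · rintro rfl
    rw [zero_pow (by omega), zero_mul] at ht'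
    exact zero_ne_one ht'
  · rw [hg, Polynomial.eval_mul, Polynomial.eval_pow, Polynomial.eval_X]
    obtain ⟨Q', rfl⟩ : ∃ Q', Q = Q' + 1 := ⟨Q - 1, by omega⟩
    rw [Nat.add_sub_cancel] at ht'
    rw [pow_succ, mul_right_comm, ht', one_mul]

variable {p} {f : ℕ} {V : Type*} [AddCommGroup V] [Module k V]

/-- An injective Frobenius-semilinear endomorphism of a nonzero finite dimensional space over an
algebraically closed field has a nonzero fixed vector. -/
theorem exists_fixed_ne_zero [FiniteDimensional k V] [Nontrivial V] (hf : 0 < f)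
    (φ : V →ₛₗ[iterateFrobenius k p f] V) (hφ : Function.Injective φ) :
    ∃ v, v ≠ 0 ∧ φ v = v := by
  classical
  have hQ : 1 < p ^ f := Nat.one_lt_pow hf.ne' (Fact.out : p.Prime).one_lt
  obtain ⟨v, hv⟩ := exists_ne (0 : V)
  let x : ℕ → V := fun i => φ^[i] v
  have hx : ∀ i, φ (x i) = x (i + 1) := fun i => (Function.iterate_succ_apply' φ i v).symm
  have hex : ∃ m, ¬ LinearIndependent k fun i : Fin m => x i :=
    ⟨Module.finrank k V + 1, fun h => by simpa using h.fintype_card_le_finrank⟩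
  obtain ⟨m, hm⟩ : ∃ m, Nat.find hex = m + 1 := by
    refine Nat.exists_eq_succ_of_ne_zero fun h => ?_
    have := Nat.find_spec hex
    rw [h] at this
    exact this linearIndependent_empty_type
  have hdep := Nat.find_spec hex
  rw [hm] at hdep
  have hind : LinearIndependent k fun i : Fin m => x i :=
    not_not.mp (Nat.find_min hex (m := m) (by omega))
  have hmem : x m ∈ Submodule.span k (Set.range fun i : Fin m => x i) := by
    by_contra h
    exact hdep (linearIndependent_finSucc'.mpr ⟨hind, h⟩)
  obtain ⟨c, hc⟩ := (Submodule.mem_span_range_iff_exists_fun k).mp hmem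
  -- After this shift x_0, …, x_m are independent and x_(m+1) is a combination of them.
  obtain ⟨m, rfl⟩ : ∃ l, m = l + 1 := by
    refine Nat.exists_eq_succ_of_ne_zero fun h => ?_
    subst h
    simp [x] at hc
    exact hv hc.symm
  let a : ℕ → k := fun i => if h : i < m + 1 then c ⟨i, h⟩ else 0
  have ha : ∑ i ∈ Finset.range (m + 1), a i • x i = x (m + 1) := by
    rw [← hc, Finset.sum_range]
    exact Finset.sum_congr rfl fun i _ => by simp only [a, dif_pos i.isLt]
  -- If a_0 = 0, extracting Q-th roots of the coefficients writes x_(m+1) as φ of a combination of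
  -- x_0, …, x_(m-1); injectivity then contradicts the independence of x_m.
  have ha0 : a 0 ≠ 0 := by
    intro h0
    rw [Finset.sum_range_succ', h0, zero_smul, add_zero] at ha
    choose r hr using iterateFrobenius_surjective (k := k) p f
    have h1 : φ (∑ i ∈ Finset.range m, r (a (i + 1)) • x i) = φ (x m) := by
      rw [hx, ← ha, map_sum]
      exact Finset.sum_congr rfl fun i _ => by rw [map_smulₛₗ, hr, hx]
    have h2 := hφ h1
    refine (linearIndependent_finSucc'.mp hind).2 ?_
    have : x m ∈ Submodule.span k (Set.range fun i : Fin m => x i) := by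
      rw [← h2]
      exact Submodule.sum_mem _ fun i hi => Submodule.smul_mem _ _
        (Submodule.subset_span ⟨⟨i, Finset.mem_range.mp hi⟩, rfl⟩)
    exact this
  -- For Σ d_i x_i to be fixed, d_0 = a_0 d_m^Q and d_(i+1) = d_i^Q + a_(i+1) d_m^Q are needed. With
  -- t = d_m these make d_i the value of `coordPoly` at t, and the condition closes up when d_m = t.
  obtain ⟨t, ht0, ht⟩ := exists_eval_coordPoly_eq_self hQ ha0 m
  let d : ℕ → k := fun i => (coordPoly (p ^ f) a i).eval t
  have hd0 : d 0 = a 0 * t ^ p ^ f := by simp [d, coordPoly]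
  have hd : ∀ i, d (i + 1) = d i ^ p ^ f + a (i + 1) * t ^ p ^ f := by
    intro i; simp [d, coordPoly]
  refine ⟨∑ i ∈ Finset.range (m + 1), d i • x i, ?_, ?_⟩
  · intro h
    rw [Finset.sum_range] at h
    exact ht0 (ht ▸ Fintype.linearIndependent_iff.mp hind (fun i => d i) h (Fin.last m))
  · have hstep : φ (∑ i ∈ Finset.range (m + 1), d i • x i)
        = ∑ i ∈ Finset.range (m + 1), d i ^ p ^ f • x (i + 1) := by
      rw [map_sum]
      exact Finset.sum_congr rfl fun i _ => by rw [map_smulₛₗ, hx, iterateFrobenius_def]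
    have hlast : d m = t := ht
    rw [hstep, Finset.sum_range_succ, hlast, ← ha, Finset.sum_range_succ' _ m,
      Finset.sum_range_succ' _ m, smul_add, Finset.smul_sum, ← add_assoc,
      ← Finset.sum_add_distrib, smul_smul, hd0, mul_comm (a 0)]
    congr 1
    refine Finset.sum_congr rfl fun i _ => ?_
    rw [hd, smul_smul, ← add_smul, mul_comm (a (i + 1))]

/-- The fixed vectors of an injective Frobenius-semilinear endomorphism of a finite dimensional
space over an algebraically closed field span the space. -/
theorem span_fixed_eq_top [FiniteDimensional k V] (hf : 0 < f)
    (φ : V →ₛₗ[iterateFrobenius k p f] V) (hφ : Function.Injective φ) :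
    Submodule.span k {v | φ v = v} = ⊤ := by
  have hQ : 1 < p ^ f := Nat.one_lt_pow hf.ne' (Fact.out : p.Prime).one_lt
  set S := Submodule.span k {v | φ v = v} with hS
  choose r hr using iterateFrobenius_surjective (k := k) p f
  have hle : S ≤ S.comap φ := Submodule.span_le.mpr fun v hv => by
    have hv' : φ v = v := hv
    simp only [SetLike.mem_coe, Submodule.mem_comap, hv']
    exact Submodule.subset_span hv
  have hroot : ∀ s ∈ S, ∃ t ∈ S, φ t = s := by
    intro s hs
    induction hs using Submodule.closure_induction with
    | zero => exact ⟨0, S.zero_mem, map_zero φ⟩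
    | add x y _ _ hx hy =>
      obtain ⟨t, ht, rfl⟩ := hx
      obtain ⟨t', ht', rfl⟩ := hy
      exact ⟨t + t', S.add_mem ht ht', map_add φ _ _⟩
    | smul_mem c x hx =>
      exact ⟨r c • x, S.smul_mem _ (Submodule.subset_span hx), by
        rw [map_smulₛₗ, hr, show φ x = x from hx]⟩
  -- On a line spanned by a fixed vector this is the Artin–Schreier equation u^Q - u = c.
  have hartin : ∀ s ∈ S, ∃ t ∈ S, φ t - t = s := by
    intro s hs
    induction hs using Submodule.closure_induction with
    | zero => exact ⟨0, S.zero_mem, by simp⟩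
    | add x y _ _ hx hy =>
      obtain ⟨t, ht, rfl⟩ := hx
      obtain ⟨t', ht', rfl⟩ := hy
      exact ⟨t + t', S.add_mem ht ht', by rw [map_add]; abel⟩
    | smul_mem c x hx =>
      obtain ⟨u, hu⟩ : ∃ u : k, u ^ p ^ f - u = c := by
        have hdeg : (Polynomial.X ^ p ^ f - Polynomial.X - Polynomial.C c : Polynomial k).degree
            ≠ 0 := by
          rw [sub_sub, Polynomial.degree_sub_eq_left_of_degree_lt]
          · rw [Polynomial.degree_X_pow]
            exact_mod_cast (by omega : p ^ f ≠ 0)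
          · rw [Polynomial.degree_X_add_C, Polynomial.degree_X_pow]
            exact_mod_cast hQ
        obtain ⟨u, hu⟩ := IsAlgClosed.exists_root _ hdeg
        refine ⟨u, ?_⟩
        simpa [Polynomial.IsRoot.def, sub_eq_zero] using hu
      refine ⟨u • x, S.smul_mem _ (Submodule.subset_span hx), ?_⟩
      rw [map_smulₛₗ, show φ x = x from hx, ← sub_smul, iterateFrobenius_def, hu]
  -- On V/S the induced map is still injective because φ maps S onto S. A nonzero fixed class there
  -- lifts to a fixed vector of V after a correction from `hartin`, yet all fixed vectors lie in S.
  by_contra hne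
  have : Nontrivial (V ⧸ S) := Submodule.Quotient.nontrivial_iff.mpr hne
  have hinj : Function.Injective (S.mapQ S φ hle) := by
    rw [injective_iff_map_eq_zero]
    intro w hw
    obtain ⟨w, rfl⟩ := S.mkQ_surjective w
    have h1 : φ w ∈ S := by simpa using hw
    obtain ⟨t, ht, ht'⟩ := hroot _ h1
    rw [← hφ ht']
    simpa using ht
  obtain ⟨w, hw0, hw⟩ := exists_fixed_ne_zero hf _ hinj
  obtain ⟨w, rfl⟩ := S.mkQ_surjective w
  have h1 : φ w - w ∈ S := by
    rw [← Submodule.Quotient.eq]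
    simpa using hw
  obtain ⟨t, ht, ht'⟩ := hartin _ h1
  have h2 : w - t ∈ S := Submodule.subset_span (by
    change φ (w - t) = w - t
    rw [map_sub]
    have : φ w = φ t - t + w := by rw [ht']; abel
    rw [this]; abel)
  apply hw0
  have : w ∈ S := by simpa using S.add_mem h2 ht
  simpa using this

end Semilinear

/-! ### Hermitian vectors of a nondegenerate form -/

section Nondegenerate

variable {k : Type*} [Field k] [IsAlgClosed k] {p : ℕ} [Fact p.Prime] [CharP k p] {e : ℕ}
  {V : Type*} [AddCommGroup V] [Module k V]

/-- The vectors `v` with `b(v, y) = b(y, v) ^ q` for all `y` span the space of a nondegenerate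
`q`-sesquilinear form. -/
theorem span_hermitian_eq_top [FiniteDimensional k V] (he : 0 < e)
    (b : V →ₗ[k] V →ₛₗ[iterateFrobenius k p e] k) (hb : ∀ y, (∀ x, b x y = 0) → y = 0) :
    Submodule.span k {v | ∀ y, b v y = b y v ^ p ^ e} = ⊤ := by
  classical
  let w := Module.finBasis k V
  let σ := iterateFrobenius k p e
  let A : Matrix _ _ k := Matrix.of fun i j => b (w i) (w j)
  have hbA : ∀ i v, b (w i) v = (A.mulVec fun j => σ (w.equivFun v j)) i := by
    intro i v
    conv_lhs => rw [← w.sum_equivFun v]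
    simp only [map_sum, map_smulₛₗ, Matrix.mulVec, dotProduct, A, Matrix.of_apply, smul_eq_mul, σ]
    exact Finset.sum_congr rfl fun j _ => mul_comm _ _
  have hAinj : Function.Injective A.mulVec := by
    rw [← Matrix.coe_mulVecLin, injective_iff_map_eq_zero]
    intro z hz
    choose r hr using iterateFrobenius_surjective (k := k) p e
    have h0 : w.equivFun.symm (fun j => r (z j)) = 0 := by
      refine hb _ fun x => ?_
      have hz' : ∀ i, b (w i) (w.equivFun.symm fun j => r (z j)) = 0 := by
        intro i
        rw [hbA]
        simp only [LinearEquiv.apply_symm_apply, σ, hr]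
        exact congrFun hz i
      rw [← w.sum_equivFun x, map_sum, LinearMap.sum_apply]
      exact Finset.sum_eq_zero fun i _ => by rw [map_smul, LinearMap.smul_apply, hz', smul_zero]
    rw [LinearEquiv.map_eq_zero_iff] at h0
    funext j
    have := congrFun h0 j
    rw [← hr (z j)]
    simp only [Pi.zero_apply] at this
    rw [this, map_zero, Pi.zero_apply]
  have hA : IsUnit A := Matrix.mulVec_injective_iff_isUnit.mp hAinj
  have hAt : IsUnit A.transpose := (Matrix.isUnit_transpose _).mpr hA
  have hAs : IsUnit (A.map σ) := by
    have := hA.map σ.mapMatrix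
    exact this
  have hAt' := (Matrix.isUnit_iff_isUnit_det _).mp hAt
  -- In coordinates, b(v, y) = b(y, v)^q for all y says Aᵀ v = A^(q) v^(q²), that is, v is fixed by
  -- v ↦ M v^(q²).
  let M := A.transpose⁻¹ * A.map σ
  have hM : IsUnit M := ((Matrix.isUnit_nonsing_inv_iff).mpr hAt).mul hAs
  let φ : V →ₛₗ[iterateFrobenius k p (e + e)] V :=
    { toFun := fun v => w.equivFun.symm
        (M.mulVec fun i => iterateFrobenius k p (e + e) (w.equivFun v i))
      map_add' := fun x y => by
        rw [← map_add, ← Matrix.mulVec_add]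
        congr 2
        funext i
        simp
      map_smul' := fun c x => by
        rw [← map_smul, ← Matrix.mulVec_smul]
        congr 2
        funext i
        simp }
  have hφ : Function.Injective φ := by
    rw [injective_iff_map_eq_zero]
    intro v hv
    have h1 : M.mulVec (fun i => iterateFrobenius k p (e + e) (w.equivFun v i)) = M.mulVec 0 := by
      rw [Matrix.mulVec_zero]
      exact (LinearEquiv.map_eq_zero_iff w.equivFun.symm).mp hv
    have h2 := Matrix.mulVec_injective_iff_isUnit.mpr hM h1
    rw [← LinearEquiv.map_eq_zero_iff w.equivFun]
    funext i
    have := congrFun h2 i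
    simpa using this
  rw [← top_le_iff, ← span_fixed_eq_top (by omega) φ hφ]
  refine Submodule.span_mono fun v hv => ?_
  have hv' : w.equivFun.symm
      (M.mulVec fun i => iterateFrobenius k p (e + e) (w.equivFun v i)) = v := hv
  rw [LinearEquiv.symm_apply_eq] at hv'
  have h1 : (A.map σ).mulVec (fun i => iterateFrobenius k p (e + e) (w.equivFun v i))
      = A.transpose.mulVec (w.equivFun v) := by
    conv_rhs =>
      rw [← hv', Matrix.mulVec_mulVec, ← mul_assoc, Matrix.mul_nonsing_inv _ hAt', one_mul]
  have h2 : ∀ i, b v (w i) = σ (b (w i) v) := by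
    intro i
    have h3 : ∑ j, σ (b (w i) (w j)) * iterateFrobenius k p (e + e) (w.equivFun v j)
        = ∑ j, b (w j) (w i) * w.equivFun v j := congrFun h1 i
    have h4 : b (w i) v = ∑ j, b (w i) (w j) * σ (w.equivFun v j) := hbA i v
    have h5 : b v (w i) = ∑ j, b (w j) (w i) * w.equivFun v j := by
      conv_lhs => rw [← w.sum_equivFun v]
      rw [map_sum, LinearMap.sum_apply]
      exact Finset.sum_congr rfl fun j _ => by
        rw [map_smul, LinearMap.smul_apply, smul_eq_mul, mul_comm]
    rw [h5, ← h3, h4, map_sum]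
    exact Finset.sum_congr rfl fun j _ => by rw [map_mul, iterateFrobenius_add_apply]
  intro y
  rw [← iterateFrobenius_def, ← w.sum_equivFun y, map_sum, map_sum, LinearMap.sum_apply, map_sum]
  exact Finset.sum_congr rfl fun i _ => by
    rw [map_smulₛₗ, h2, map_smul, LinearMap.smul_apply, smul_eq_mul, smul_eq_mul, map_mul]

/-- A nondegenerate `q`-sesquilinear form has a unit vector whose left and right orthogonals
coincide. -/
theorem exists_unit_vector [FiniteDimensional k V] [Nontrivial V] (he : 0 < e)
    (b : V →ₗ[k] V →ₛₗ[iterateFrobenius k p e] k) (hb : ∀ y, (∀ x, b x y = 0) → y = 0) :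
    ∃ v, b v v = 1 ∧ ∀ y, b v y = 0 ↔ b y v = 0 := by
  have hQ : 1 < p ^ e := Nat.one_lt_pow he.ne' (Fact.out : p.Prime).one_lt
  set F := {v | ∀ y, b v y = b y v ^ p ^ e} with hF
  have hspan := span_hermitian_eq_top he b hb
  obtain ⟨f, hfF, hf⟩ : ∃ f ∈ F, b f f ≠ 0 := by
    by_contra! hzero
    have hFF : ∀ x ∈ F, ∀ y ∈ F, b x y = 0 := by
      intro x hx y hy
      by_contra hxy
      have hyx : b y x ≠ 0 := fun h => hxy (by rw [hx y, h, zero_pow (by omega)])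
      -- The vector x + c y with c b(y, x) = δ has b-value δ + δ^q = 1. Both δ and b(y, x) are fixed
      -- by the q²-power map, hence so is c, and F is stable under such scalars.
      obtain ⟨δ, hδ⟩ : ∃ δ : k, δ ^ p ^ e + δ = 1 := by
        have hdeg : (Polynomial.X ^ p ^ e + Polynomial.X - Polynomial.C 1 : Polynomial k).degree
            ≠ 0 := by
          rw [add_sub_assoc, Polynomial.degree_add_eq_left_of_degree_lt]
          · rw [Polynomial.degree_X_pow]
            exact_mod_cast (by omega : p ^ e ≠ 0)
          · rw [Polynomial.degree_X_sub_C, Polynomial.degree_X_pow]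
            exact_mod_cast hQ
        obtain ⟨u, hu⟩ := IsAlgClosed.exists_root _ hdeg
        refine ⟨u, ?_⟩
        simpa [Polynomial.IsRoot.def, sub_eq_zero] using hu
      have hδ2 : (δ ^ p ^ e) ^ p ^ e = δ := by
        have h : δ ^ p ^ e = 1 - δ := eq_sub_of_add_eq hδ
        rw [h, sub_pow_char_pow, one_pow, h]; ring
      set c := δ / b y x with hc
      have hβ : (b y x ^ p ^ e) ^ p ^ e = b y x := by rw [← hx y, ← hy x]
      have hc2 : (c ^ p ^ e) ^ p ^ e = c := by rw [hc, div_pow, div_pow, hδ2, hβ]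
      have hmem : x + c • y ∈ F := by
        intro z
        simp only [map_add, LinearMap.add_apply, map_smul, LinearMap.smul_apply, smul_eq_mul,
          map_smulₛₗ, iterateFrobenius_def]
        rw [add_pow_char_pow, mul_pow, hc2, hx z, hy z]
      have h := hzero _ hmem
      simp only [map_add, LinearMap.add_apply, map_smul, LinearMap.smul_apply, smul_eq_mul,
        map_smulₛₗ, iterateFrobenius_def, hzero x hx, hzero y hy] at h
      have h1 : c * b y x = δ := by rw [hc, div_mul_cancel₀ _ hyx]
      have h2 : c ^ p ^ e * b x y = δ ^ p ^ e := by rw [hx y, ← mul_pow, h1]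
      have : (1 : k) = 0 := by linear_combination h - h1 - h2 - hδ
      exact one_ne_zero this
    -- Vanishing on F × F extends to the whole space because F spans, against nondegeneracy.
    obtain ⟨v, hv⟩ := exists_ne (0 : V)
    refine hv (hb v fun x => ?_)
    have h1 : ∀ y ∈ F, ∀ x, b x y = 0 := by
      intro y hy x
      have hx : x ∈ Submodule.span k F := hspan ▸ Submodule.mem_top
      induction hx using Submodule.span_induction with
      | mem x hx => exact hFF x hx y hy
      | zero => simp
      | add x y _ _ hx hy => simp [hx, hy]
      | smul c x _ hx => simp [hx]
    have hv' : v ∈ Submodule.span k F := hspan ▸ Submodule.mem_top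
    clear hv
    induction hv' using Submodule.span_induction with
    | mem y hy => exact h1 y hy x
    | zero => simp
    | add x y _ _ hx hy => simp [hx, hy]
    | smul c x _ hx => simp [hx]
  -- Scaling f by l multiplies b(f, f) by l^(q+1).
  obtain ⟨l, hl⟩ := IsAlgClosed.exists_pow_nat_eq (b f f)⁻¹ (n := p ^ e + 1) (by omega)
  have hl0 : l ≠ 0 := by
    rintro rfl
    rw [zero_pow (by omega)] at hl
    exact inv_ne_zero hf hl.symm
  refine ⟨l • f, ?_, fun y => ?_⟩
  · simp only [map_smul, LinearMap.smul_apply, smul_eq_mul, map_smulₛₗ, iterateFrobenius_def]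
    rw [← mul_assoc, ← pow_succ, hl, inv_mul_cancel₀ hf]
  · simp only [map_smul, LinearMap.smul_apply, smul_eq_mul, map_smulₛₗ, iterateFrobenius_def]
    rw [hfF y]
    rw [mul_eq_zero, or_iff_right hl0, mul_eq_zero, or_iff_right (pow_ne_zero _ hl0),
      pow_eq_zero_iff (by omega)]

/-- Relative version of `exists_unit_vector` in a subspace. -/
theorem exists_unit_vector_mem [FiniteDimensional k V] (he : 0 < e)
    (b : V →ₗ[k] V →ₛₗ[iterateFrobenius k p e] k) (U : Submodule k V) (hU : U ≠ ⊥)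
    (hb : ∀ y ∈ U, (∀ x ∈ U, b x y = 0) → y = 0) :
    ∃ v ∈ U, b v v = 1 ∧ ∀ y ∈ U, b v y = 0 ↔ b y v = 0 := by
  have : Nontrivial U := (Submodule.nontrivial_iff_ne_bot).mpr hU
  obtain ⟨v, hv, h⟩ := exists_unit_vector (V := U) he (b.domRestrict₁₂ U U) fun y hy =>
    Subtype.ext (hb y y.2 fun x hx => hy ⟨x, hx⟩)
  exact ⟨v, v.2, hv, fun y hy => h ⟨y, hy⟩⟩

end Nondegenerate

/-! ### Splitting off a line by a semilinear functional -/

section Hyperplane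

variable {k : Type*} [Field k] {V : Type*} [AddCommGroup V] [Module k V] {τ : k →+* k}
  [RingHomSurjective τ]

theorem exists_smul_add_of_apply_ne_zero (ℓ : V →ₛₗ[τ] k) (U : Submodule k V) {z : V} (hz : z ∈ U)
    (hℓ : ℓ z ≠ 0) {x : V} (hx : x ∈ U) : ∃ c : k, ∃ y ∈ U ⊓ ℓ.ker, x = c • z + y := by
  obtain ⟨c, hc⟩ := RingHomSurjective.is_surjective (σ := τ) (ℓ x / ℓ z)
  refine ⟨c, x - c • z, ⟨U.sub_mem hx (U.smul_mem _ hz), ?_⟩, by abel⟩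
  rw [SetLike.mem_coe, LinearMap.mem_ker, map_sub, map_smulₛₗ, hc, smul_eq_mul,
    div_mul_cancel₀ _ hℓ, sub_self]

theorem finrank_inf_ker_add_one [FiniteDimensional k V] (ℓ : V →ₛₗ[τ] k) (U : Submodule k V)
    {z : V} (hz : z ∈ U) (hℓ : ℓ z ≠ 0) :
    Module.finrank k (U ⊓ ℓ.ker : Submodule k V) + 1 = Module.finrank k U := by
  have hz0 : z ≠ 0 := by rintro rfl; exact hℓ (map_zero ℓ)
  have h1 : (U ⊓ ℓ.ker) ⊔ Submodule.span k {z} = U := by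
    refine le_antisymm (sup_le inf_le_left ?_) fun x hx => ?_
    · rwa [Submodule.span_singleton_le_iff_mem]
    · obtain ⟨c, y, hy, rfl⟩ := exists_smul_add_of_apply_ne_zero ℓ U hz hℓ hx
      exact add_mem (Submodule.mem_sup_right (Submodule.smul_mem _ _
        (Submodule.mem_span_singleton_self z))) (Submodule.mem_sup_left hy)
  have h2 : (U ⊓ ℓ.ker) ⊓ Submodule.span k {z} = ⊥ := by
    rw [eq_bot_iff]
    rintro x ⟨⟨_, hx⟩, hx'⟩
    obtain ⟨c, rfl⟩ := Submodule.mem_span_singleton.mp hx'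
    have : τ c * ℓ z = 0 := by
      rw [← smul_eq_mul, ← map_smulₛₗ]
      exact hx
    have hc : c = 0 := by simpa [hℓ] using this
    simp [hc]
  have h3 := Submodule.finrank_sup_add_finrank_inf_eq (U ⊓ ℓ.ker) (Submodule.span k {z})
  rw [h1, h2, finrank_bot, finrank_span_singleton hz0] at h3
  omega

end Hyperplane

/-! ### Bases adapted to diag(I_s, E_r), and their extension -/

section Adapted

variable {k : Type*} [Field k] {V : Type*} [AddCommGroup V] [Module k V] {σ : k →+* k}

/-- A spanning family of a subspace in which a sesquilinear form has the matrix
`diag(I_s, E_r)`. -/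
structure IsAdapted (b : V →ₗ[k] V →ₛₗ[σ] k) (U : Submodule k V) {s : ℕ} (u : Fin s → V)
    (r : ℕ) (w : ℕ → V) : Prop where
  left_mem : ∀ i, u i ∈ U
  right_mem : ∀ i < r, w i ∈ U
  right_ne_zero : ∀ i < r, w i ≠ 0
  le_span : U ≤ Submodule.span k (Set.range u ∪ w '' Set.Iio r)
  left_left : ∀ i j, b (u i) (u j) = if i = j then 1 else 0
  left_right : ∀ i, ∀ j < r, b (u i) (w j) = 0
  right_left : ∀ i < r, ∀ j, b (w i) (u j) = 0
  right_right : ∀ i < r, ∀ j < r, b (w i) (w j) = if i = j + 1 then 1 else 0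
  card : s + r = Module.finrank k U

variable {b : V →ₗ[k] V →ₛₗ[σ] k} {U : Submodule k V} {s r : ℕ} {u : Fin s → V} {w : ℕ → V}

/-- On the left, u_i is dual to u_i and w_(j+1) is dual to w_j, so these vectors can cancel the
values of b(z, ·). The last w has no dual in the family, which is why j + 1 < r is required. -/
theorem IsAdapted.exists_orthogonal_translate (h : IsAdapted b U u r w) (z : V) :
    ∃ y ∈ U, (∀ j, b (z + y) (u j) = 0) ∧ ∀ j, j + 1 < r → b (z + y) (w j) = 0 := by
  refine ⟨∑ i, (-b z (u i)) • u i + ∑ j ∈ Finset.range (r - 1), (-b z (w j)) • w (j + 1),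
    add_mem (sum_mem fun i _ => U.smul_mem _ (h.left_mem i)) (sum_mem fun j hj =>
      U.smul_mem _ (h.right_mem _ (by have := Finset.mem_range.mp hj; omega))),
    fun j => ?_, fun j hj => ?_⟩
  · have h1 : ∑ i ∈ Finset.range (r - 1), (-b z (w i)) * b (w (i + 1)) (u j) = 0 :=
      Finset.sum_eq_zero fun i hi => by
        rw [h.right_left _ (by have := Finset.mem_range.mp hi; omega), mul_zero]
    simp only [map_add, map_sum, LinearMap.add_apply, LinearMap.sum_apply, map_smul,
      LinearMap.smul_apply, smul_eq_mul, h1, h.left_left]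
    simp
  · have h1 : ∑ i, (-b z (u i)) * b (u i) (w j) = 0 :=
      Finset.sum_eq_zero fun i _ => by rw [h.left_right _ _ (by omega), mul_zero]
    have h2 : ∑ i ∈ Finset.range (r - 1), (-b z (w i)) * b (w (i + 1)) (w j) = -b z (w j) := by
      rw [Finset.sum_eq_single j]
      · rw [h.right_right _ hj _ (by omega), if_pos rfl, mul_one]
      · intro i hi hij
        rw [h.right_right _ (by have := Finset.mem_range.mp hi; omega) _ (by omega),
          if_neg (by omega), mul_zero]
      · intro hj'
        exact absurd (Finset.mem_range.mpr (by omega)) hj'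
    simp only [map_add, map_sum, LinearMap.add_apply, LinearMap.sum_apply, map_smul,
      LinearMap.smul_apply, smul_eq_mul, h1, h2]
    simp

/-- The nilpotent block grows by two when a right radical vector `ρ` and a vector `z` with
`b(ρ, z) ≠ 0` are added. -/
theorem IsAdapted.extend (h : IsAdapted b U u r w) {W : Submodule k V} (hUW : U ≤ W) {ρ z : V}
    (hρ : ρ ∈ W) (hz : z ∈ W) (hrad : ∀ x ∈ W, b x ρ = 0) (hρU : ∀ y ∈ U, b ρ y = 0)
    (hρz : b ρ z ≠ 0) (hdec : ∀ x ∈ W, ∃ c d : k, ∃ y ∈ U, x = c • z + d • ρ + y)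
    (hU : ∀ y ∈ U, (∀ x ∈ W, b x y = 0) → y = 0)
    (hcard : Module.finrank k U + 2 = Module.finrank k W) :
    ∃ (u' : Fin s → V) (w' : ℕ → V), IsAdapted b W u' (r + 2) w' := by
  have hρ0 : ρ ≠ 0 := by rintro rfl; simp at hρz
  obtain ⟨y₁, hy₁, hz₁u, hz₁w⟩ := h.exists_orthogonal_translate z
  set z₁ := z + y₁ with hz₁
  have hz₁W : z₁ ∈ W := add_mem hz (hUW hy₁)
  have hρz₁ : b ρ z₁ ≠ 0 := by rwa [hz₁, map_add, hρU _ hy₁, add_zero]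
  -- All of U pairs to zero with the last w on its right, and so does ρ. If z₁ did too, this w would
  -- lie in the right radical of W, which meets U in 0. For r = 0 there is nothing to normalize.
  obtain ⟨l, hl0, hl⟩ : ∃ l : k, l ≠ 0 ∧ ∀ j, j + 1 = r → b (l • z₁) (w j) = 1 := by
    rcases r with _ | r
    · exact ⟨1, one_ne_zero, fun j hj => absurd hj (by omega)⟩
    · have hne : b z₁ (w r) ≠ 0 := by
        intro h0
        refine h.right_ne_zero r (by omega) (hU _ (h.right_mem r (by omega)) fun x hx => ?_)
        have hUr : ∀ y ∈ U, b y (w r) = 0 := by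
          intro y hy
          replace hy := h.le_span hy
          induction hy using Submodule.span_induction with
          | mem y hy =>
            rcases hy with ⟨i, rfl⟩ | ⟨i, hi, rfl⟩
            · exact h.left_right _ _ (by omega)
            · have hi' : i < r + 1 := hi
              rw [h.right_right _ hi' _ (by omega), if_neg (by omega)]
          | zero => simp
          | add x y _ _ hx hy => rw [map_add, LinearMap.add_apply, hx, hy, add_zero]
          | smul c x _ hx => rw [map_smul, LinearMap.smul_apply, hx, smul_zero]
        obtain ⟨c, d, y, hy, rfl⟩ := hdec x hx
        have hzw : b z (w r) = 0 := by
          rwa [hz₁, map_add, LinearMap.add_apply, hUr _ hy₁, add_zero] at h0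
        simp [hzw, hUr y hy, hρU _ (h.right_mem r (by omega))]
      refine ⟨(b z₁ (w r))⁻¹, inv_ne_zero hne, fun j hj => ?_⟩
      obtain rfl : j = r := by omega
      simp [hne]
  set z₂ := l • z₁ with hz₂
  have hz₂W : z₂ ∈ W := W.smul_mem _ hz₁W
  have hρz₂ : b ρ z₂ ≠ 0 := by
    rw [hz₂, map_smulₛₗ, smul_eq_mul]
    exact mul_ne_zero ((map_ne_zero σ).mpr hl0) hρz₁
  have hz₂u : ∀ j, b z₂ (u j) = 0 := fun j => by
    rw [hz₂, map_smul, LinearMap.smul_apply, hz₁u, smul_zero]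
  have hz₂w : ∀ j < r, b z₂ (w j) = if r = j + 1 then 1 else 0 := by
    intro j hj
    split_ifs with hjr
    · exact hl j hjr.symm
    · rw [hz₂, map_smul, LinearMap.smul_apply, hz₁w j (by omega), smul_zero]
  set ρ₂ := (b ρ z₂)⁻¹ • ρ with hρ₂
  have hρ₂W : ρ₂ ∈ W := W.smul_mem _ hρ
  have hρ₂0 : ρ₂ ≠ 0 := smul_ne_zero (inv_ne_zero hρz₂) hρ0
  have hρ₂z : b ρ₂ z₂ = 1 := 
    (LinearMap.map_smul₂ b _ ρ z₂).trans (by rw [smul_eq_mul, inv_mul_cancel₀ hρz₂])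
  have hρ₂U : ∀ y ∈ U, b ρ₂ y = 0 := fun y hy => by
    rw [hρ₂, map_smul, LinearMap.smul_apply, hρU y hy, smul_zero]
  have hrad₂ : ∀ x ∈ W, b x ρ₂ = 0 := fun x hx => by
    rw [hρ₂, map_smulₛₗ, hrad x hx, smul_zero]
  -- As ρ₂ is in the right radical of W and left orthogonal to U, T preserves the pairings of W with
  -- U. As b(ρ₂, z₂) = 1, it makes the image of W left orthogonal to T z₂.
  let T : V → V := fun x => x - b x z₂ • ρ₂
  have hT : ∀ x, T x = x - b x z₂ • ρ₂ := fun _ => rfl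
  have hTW : ∀ x ∈ W, T x ∈ W := fun x hx => W.sub_mem hx (W.smul_mem _ hρ₂W)
  have hbT : ∀ x ∈ W, ∀ y, b x (T y) = b x y := fun x hx y => by
    rw [hT, map_sub, map_smulₛₗ, hrad₂ x hx, smul_zero, sub_zero]
  have hTb : ∀ x y, b (T x) y = b x y - b x z₂ * b ρ₂ y := fun x y => by
    rw [hT, map_sub, map_smul, LinearMap.sub_apply, LinearMap.smul_apply, smul_eq_mul]
  have hTU : ∀ x ∈ W, ∀ y ∈ U, b (T x) (T y) = b x y := fun x hx y hy => by
    rw [hbT _ (hTW x hx), hTb, hρ₂U y hy, mul_zero, sub_zero]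
  have hTz : ∀ x ∈ W, b (T x) (T z₂) = 0 := fun x hx => by
    rw [hbT _ (hTW x hx), hTb, hρ₂z, mul_one, sub_self]
  have hρT : ∀ y, b ρ₂ (T y) = b ρ₂ y := hbT ρ₂ hρ₂W
  -- The two new subdiagonal entries are b(z₂, w_(r-1)) = 1 (when r > 0) and b(ρ₂, z₂) = 1.
  let w' : ℕ → V := fun i => if i < r then T (w i) else if i = r then T z₂ else ρ₂
  have hw1 : ∀ i < r, w' i = T (w i) := fun i hi => if_pos hi
  have hw2 : w' r = T z₂ := by simp [w']
  have hw3 : w' (r + 1) = ρ₂ := by simp [w']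
  have hcases : ∀ i < r + 2, i < r ∨ i = r ∨ i = r + 1 := fun i hi => by omega
  have huW := fun i => hUW (h.left_mem i)
  have hwW := fun i hi => hUW (h.right_mem i hi)
  have hw'W : ∀ i < r + 2, w' i ∈ W := by
    intro i hi
    rcases hcases i hi with hi | rfl | rfl
    · rw [hw1 i hi]; exact hTW _ (hwW i hi)
    · rw [hw2]; exact hTW _ hz₂W
    · rw [hw3]; exact hρ₂W
  refine ⟨fun i => T (u i), w', fun i => hTW _ (huW i), hw'W, ?_, ?_, ?_, ?_, ?_, ?_, ?_⟩
  · intro i hi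
    rcases hcases i hi with hi | rfl | rfl
    · intro h0
      rw [hw1 i hi, hT, sub_eq_zero] at h0
      refine h.right_ne_zero i hi (hU _ (h.right_mem i hi) fun x hx => ?_)
      rw [h0, map_smulₛₗ, hrad₂ x hx, smul_zero]
    · intro h0
      rw [hw2] at h0
      have := hρT z₂
      rw [h0, map_zero, hρ₂z] at this
      exact zero_ne_one this
    · rwa [hw3]
  · set S := Submodule.span k (Set.range (fun i => T (u i)) ∪ w' '' Set.Iio (r + 2))
    have hwS : ∀ i < r + 2, w' i ∈ S := fun i hi =>
      Submodule.subset_span (Or.inr ⟨i, hi, rfl⟩)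
    have hρ₂S : ρ₂ ∈ S := hw3 ▸ hwS (r + 1) (by omega)
    have hTS : ∀ x, T x ∈ S → x ∈ S := fun x hx => by
      have := S.add_mem hx (S.smul_mem (b x z₂) hρ₂S)
      rwa [hT, sub_add_cancel] at this
    have hUS : U ≤ S := h.le_span.trans (Submodule.span_le.mpr (by
      rintro _ (⟨i, rfl⟩ | ⟨i, hi, rfl⟩)
      · exact hTS _ (Submodule.subset_span (Or.inl ⟨i, rfl⟩))
      · have hi' : i < r := hi
        exact hTS _ (hw1 i hi ▸ hwS i (by omega))))
    have hz₂S : z₂ ∈ S := hTS _ (hw2 ▸ hwS r (by omega))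
    have hρS : ρ ∈ S := by
      have := S.smul_mem (b ρ z₂) hρ₂S
      rwa [hρ₂, smul_inv_smul₀ hρz₂] at this
    have hz₁S : z₁ ∈ S := by
      have := S.smul_mem l⁻¹ hz₂S
      rwa [hz₂, inv_smul_smul₀ hl0] at this
    have hzS : z ∈ S := by
      have := S.sub_mem hz₁S (hUS hy₁)
      rwa [hz₁, add_sub_cancel_right] at this
    intro x hx
    obtain ⟨c, d, y, hy, rfl⟩ := hdec x hx
    exact add_mem (add_mem (S.smul_mem _ hzS) (S.smul_mem _ hρS)) (hUS hy)
  · intro i j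
    rw [hTU _ (huW i) _ (h.left_mem j), h.left_left]
  · intro i j hj
    rcases hcases j hj with hj | rfl | rfl
    · rw [hw1 j hj, hTU _ (huW i) _ (h.right_mem j hj), h.left_right i j hj]
    · rw [hw2, hTz _ (huW i)]
    · rw [hw3, hrad₂ _ (hTW _ (huW i))]
  · intro i hi j
    rcases hcases i hi with hi | rfl | rfl
    · rw [hw1 i hi, hTU _ (hwW i hi) _ (h.left_mem j), h.right_left i hi]
    · rw [hw2, hTU _ hz₂W _ (h.left_mem j), hz₂u]
    · rw [hw3, hρT, hρ₂U _ (h.left_mem j)]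
  · intro i hi j hj
    rcases hcases j hj with hj | rfl | rfl
    · rw [hw1 j hj]
      rcases hcases i hi with hi | rfl | rfl
      · rw [hw1 i hi, hTU _ (hwW i hi) _ (h.right_mem j hj), h.right_right i hi j hj]
      · rw [hw2, hTU _ hz₂W _ (h.right_mem j hj), hz₂w j hj]
      · rw [hw3, hρT, hρ₂U _ (h.right_mem j hj), if_neg (by omega)]
    · rw [hw2]
      rcases hcases i hi with hi | rfl | rfl
      · rw [hw1 i hi, hTz _ (hwW i hi), if_neg (by omega)]
      · rw [hw2, hTz _ hz₂W, if_neg (by omega)]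
      · rw [hw3, hρT, hρ₂z, if_pos rfl]
    · rw [hw3, hrad₂ _ (hw'W i hi), if_neg (by omega)]
  · have := h.card
    omega

end Adapted

/-! ### Existence of adapted bases -/

section Existence

variable {k : Type*} [Field k] [IsAlgClosed k] {p : ℕ} [Fact p.Prime] [CharP k p] {e : ℕ}
  {V : Type*} [AddCommGroup V] [Module k V] [FiniteDimensional k V]

instance : RingHomSurjective (iterateFrobenius k p e) := ⟨iterateFrobenius_surjective p e⟩

/-- A nondegenerate `q`-sesquilinear form over an algebraically closed field has an orthonormal
basis. -/
theorem exists_isAdapted_of_nondegenerate (he : 0 < e)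
    (b : V →ₗ[k] V →ₛₗ[iterateFrobenius k p e] k) (d : ℕ) (U : Submodule k V)
    (hd : Module.finrank k U = d) (hU : ∀ y ∈ U, (∀ x ∈ U, b x y = 0) → y = 0) :
    ∃ u : Fin d → V, IsAdapted b U u 0 0 := by
  induction d generalizing U with
  | zero =>
    rw [Submodule.finrank_eq_zero] at hd
    subst hd
    exact ⟨0, by constructor <;> simp⟩
  | succ d ih =>
    have hne : U ≠ ⊥ := by rintro rfl; simp at hd
    obtain ⟨v, hv, hvv, hperp⟩ := exists_unit_vector_mem he b U hne hU
    have hvv0 : b v v ≠ 0 := by rw [hvv]; exact one_ne_zero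
    have hcard := finrank_inf_ker_add_one (b v) U hv hvv0
    have hdec := fun x (hx : x ∈ U) => exists_smul_add_of_apply_ne_zero (b v) U hv hvv0 hx
    obtain ⟨u, hu⟩ := ih (U ⊓ (b v).ker) (by omega) fun y hy hrad => hU y hy.1 fun x hx => by
      obtain ⟨c, x', hx', rfl⟩ := hdec x hx
      rw [map_add, map_smul, LinearMap.add_apply, LinearMap.smul_apply, hrad x' hx',
        show b v y = 0 from hy.2, smul_zero, zero_add]
    have hvu : ∀ i, b v (u i) = 0 := fun i => (hu.left_mem i).2
    -- The coincidence of the two orthogonals of v makes the splitting orthogonal on both sides.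
    have huv : ∀ i, b (u i) v = 0 := fun i => (hperp _ (hu.left_mem i).1).mp (hvu i)
    refine ⟨Fin.cons v u, ?_, by simp, by simp, ?_, ?_, by simp, by simp, by simp, by omega⟩
    · intro i
      refine Fin.cases ?_ (fun i => ?_) i
      · exact hv
      · exact (hu.left_mem i).1
    · have hle := hu.le_span
      have h0 : Set.Iio 0 = (∅ : Set ℕ) := by ext; simp
      rw [h0, Set.image_empty, Set.union_empty] at hle ⊢
      rw [Fin.range_cons]
      intro x hx
      obtain ⟨c, x', hx', rfl⟩ := hdec x hx
      exact add_mem (Submodule.smul_mem _ _ (Submodule.subset_span (Set.mem_insert _ _)))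
        (Submodule.span_mono (Set.subset_insert _ _) (hle hx'))
    · intro i j
      refine Fin.cases ?_ (fun i => ?_) i <;> refine Fin.cases ?_ (fun j => ?_) j
      · simp [hvv]
      · simp [hvu, (Fin.succ_ne_zero j).symm]
      · simp [huv]
      · simp [hu.left_left]

/-- A `q`-sesquilinear form over an algebraically closed field whose right radical is at most
one-dimensional has the matrix `diag(I_s, E_r)` in a suitable basis. -/
theorem exists_isAdapted (he : 0 < e) (b : V →ₗ[k] V →ₛₗ[iterateFrobenius k p e] k) (d : ℕ)
    (U : Submodule k V) (hd : Module.finrank k U = d) {ρ : V} (hρU : ρ ∈ U)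
    (hρ : ∀ x ∈ U, b x ρ = 0) (hrad : ∀ y ∈ U, (∀ x ∈ U, b x y = 0) → ∃ c : k, y = c • ρ) :
    ∃ (s r : ℕ) (u : Fin s → V) (w : ℕ → V), IsAdapted b U u r w := by
  induction d using Nat.strong_induction_on generalizing U ρ with
  | _ d ih =>
    by_cases hρ0 : ρ = 0
    · obtain ⟨u, hu⟩ := exists_isAdapted_of_nondegenerate he b d U hd fun y hy h => by
        obtain ⟨c, rfl⟩ := hrad y hy h
        rw [hρ0, smul_zero]
      exact ⟨d, 0, u, 0, hu⟩
    obtain ⟨ℓ, hℓ⟩ : ∃ ℓ : Module.Dual k V, ℓ ρ ≠ 0 := by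
      by_contra! h
      exact hρ0 ((Module.forall_dual_apply_eq_zero_iff k ρ).mp h)
    have hradℓ : ∀ y ∈ U, ℓ y = 0 → (∀ x ∈ U, b x y = 0) → y = 0 := by
      intro y hy hy0 h
      obtain ⟨c, rfl⟩ := hrad y hy h
      rw [map_smul, smul_eq_mul, mul_eq_zero, or_iff_left hℓ] at hy0
      rw [hy0, zero_smul]
    -- Here ρ is orthogonal to U on both sides: it forms a block E_1, and the form on the complement
    -- cut out by ℓ is nondegenerate.
    by_cases hleft : ∀ y ∈ U, b ρ y = 0
    · have hcard := finrank_inf_ker_add_one ℓ U hρU hℓ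
      have hdec := fun x (hx : x ∈ U) => exists_smul_add_of_apply_ne_zero ℓ U hρU hℓ hx
      obtain ⟨u, hu⟩ := exists_isAdapted_of_nondegenerate he b _ (U ⊓ ℓ.ker) rfl
        fun y hy h => hradℓ y hy.1 hy.2 fun x hx => by
          obtain ⟨c, x', hx', rfl⟩ := hdec x hx
          rw [map_add, map_smul, LinearMap.add_apply, LinearMap.smul_apply, h x' hx',
            hleft y hy.1, smul_zero, zero_add]
      have huU := fun i => (hu.left_mem i).1
      refine ⟨_, 1, u, fun _ => ρ, huU, fun _ _ => hρU, fun _ _ => hρ0, ?_, hu.left_left,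
        fun i _ _ => hρ _ (huU i), fun _ _ j => hleft _ (huU j), ?_, hcard⟩
      · intro x hx
        obtain ⟨c, x', hx', rfl⟩ := hdec x hx
        refine add_mem (Submodule.smul_mem _ _ (Submodule.subset_span (Or.inr ⟨0, by simp, rfl⟩)))
          (Submodule.span_mono ?_ (hu.le_span hx'))
        simp
      · intro i hi j hj
        rw [hρ ρ hρU, if_neg (by omega)]
    · push Not at hleft
      obtain ⟨z, hzU, hz⟩ := hleft
      have hρρ := hρ ρ hρU
      have hcard1 := finrank_inf_ker_add_one (b ρ) U hzU hz
      have hdec1 := fun x (hx : x ∈ U) => exists_smul_add_of_apply_ne_zero (b ρ) U hzU hz hx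
      have hρU1 : ρ ∈ U ⊓ (b ρ).ker := ⟨hρU, hρρ⟩
      have hcard2 := finrank_inf_ker_add_one ℓ _ hρU1 hℓ
      -- The kernel of b(ρ, ·) splits off z and the kernel of ℓ splits off ρ, so U = ⟨z⟩ ⊕ ⟨ρ⟩ ⊕ U'.
      set U' := U ⊓ (b ρ).ker ⊓ ℓ.ker with hU'
      have hU'U : U' ≤ U := inf_le_left.trans inf_le_left
      have hdec : ∀ x ∈ U, ∃ c d : k, ∃ y ∈ U', x = c • z + d • ρ + y := by
        intro x hx
        obtain ⟨c, x', hx', rfl⟩ := hdec1 x hx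
        obtain ⟨d, y, hy, rfl⟩ := exists_smul_add_of_apply_ne_zero ℓ _ hρU1 hℓ hx'
        exact ⟨c, d, y, hy, (add_assoc _ _ _).symm⟩
      have hρU' : ∀ y ∈ U', b ρ y = 0 := fun y hy => hy.1.2
      have hradU' : ∀ y ∈ U', (∀ x ∈ U, b x y = 0) → y = 0 := fun y hy =>
        hradℓ y (hU'U hy) hy.2
      -- Thus b(z, ·) is injective on the right radical of U', which therefore has dimension at most
      -- one.
      have hradz : ∀ y ∈ U', (∀ x ∈ U', b x y = 0) → b z y = 0 → y = 0 := by
        intro y hy h hzy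
        refine hradU' y hy fun x hx => ?_
        obtain ⟨c, d, x', hx', rfl⟩ := hdec x hx
        simp [hzy, hρU' y hy, h x' hx']
      obtain ⟨ρ', hρ'U, hρ', hrad'⟩ : ∃ ρ' ∈ U', (∀ x ∈ U', b x ρ' = 0) ∧
          ∀ y ∈ U', (∀ x ∈ U', b x y = 0) → ∃ c : k, y = c • ρ' := by
        by_cases h0 : ∀ y ∈ U', (∀ x ∈ U', b x y = 0) → y = 0
        · exact ⟨0, U'.zero_mem, by simp, fun y hy h => ⟨0, by rw [h0 y hy h, smul_zero]⟩⟩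
        · push Not at h0
          obtain ⟨ρ', hρ'U, hρ', hρ'0⟩ := h0
          refine ⟨ρ', hρ'U, hρ', fun y hy h => ?_⟩
          have hzρ' : b z ρ' ≠ 0 := fun h => hρ'0 (hradz ρ' hρ'U hρ' h)
          obtain ⟨c, hc⟩ := iterateFrobenius_surjective p e (b z y / b z ρ')
          refine ⟨c, sub_eq_zero.mp (hradz _ (U'.sub_mem hy (U'.smul_mem _ hρ'U)) ?_ ?_)⟩
          · intro x hx
            rw [map_sub, map_smulₛₗ, h x hx, hρ' x hx, smul_zero, sub_zero]
          · rw [map_sub, map_smulₛₗ, hc, smul_eq_mul, div_mul_cancel₀ _ hzρ', sub_self]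
      obtain ⟨s, r, u, w, huw⟩ := ih (Module.finrank k U') (by omega) U' rfl hρ'U hρ' hrad'
      obtain ⟨u', w', h⟩ := huw.extend hU'U hρU hzU hρ hρU' hz hdec hradU' (by omega)
      exact ⟨s, r + 2, u', w', h⟩

end Existence

/-! ### Matrices, sesquilinear forms and q-congruence -/

section Congruence

variable {k : Type*} [Field k] (p : ℕ) [Fact p.Prime] [CharP k p] (e : ℕ) {n : ℕ}

/-- The `q`-sesquilinear form `(x, y) ↦ ∑ a_ij x_i y_j ^ q` of a matrix. -/
def sesq (A : Matrix (Fin (n + 1)) (Fin (n + 1)) k) :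
    (Fin (n + 1) → k) →ₗ[k] (Fin (n + 1) → k) →ₛₗ[iterateFrobenius k p e] k :=
  Matrix.toLinearMap₂'Aux (RingHom.id k) (iterateFrobenius k p e) A

theorem sesq_apply (A : Matrix (Fin (n + 1)) (Fin (n + 1)) k) (x y : Fin (n + 1) → k) :
    sesq p e A x y = ∑ i, ∑ j, A i j * x i * y j ^ p ^ e := by
  rw [sesq, Matrix.toLinearMap₂'Aux, LinearMap.mk₂'ₛₗ_apply]
  refine Finset.sum_congr rfl fun i _ => Finset.sum_congr rfl fun j _ => ?_
  rw [RingHom.id_apply, iterateFrobenius_def, smul_eq_mul, smul_eq_mul]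
  ring

theorem sesq_eq_dotProduct (A : Matrix (Fin (n + 1)) (Fin (n + 1)) k) (x y : Fin (n + 1) → k) :
    sesq p e A x y = x ⬝ᵥ A.mulVec fun j => iterateFrobenius k p e (y j) := by
  rw [sesq_apply]
  simp only [dotProduct, Matrix.mulVec, Finset.mul_sum]
  refine Finset.sum_congr rfl fun i _ => Finset.sum_congr rfl fun j _ => ?_
  rw [iterateFrobenius_def]
  ring

theorem sesq_apply_eq_zero_iff (A : Matrix (Fin (n + 1)) (Fin (n + 1)) k) (y : Fin (n + 1) → k) :
    (∀ x, sesq p e A x y = 0) ↔ A.mulVec (fun j => iterateFrobenius k p e (y j)) = 0 := by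
  simp only [sesq_eq_dotProduct]
  exact ⟨fun h => dotProduct_eq_zero _ fun x => by rw [dotProduct_comm]; exact h x,
    fun h x => by rw [h, dotProduct_zero]⟩

/-- The matrix of the form `∑ a_ij x_i x_j ^ q` after the substitution `x ↦ T x`. -/
def qCongr (T A : Matrix (Fin (n + 1)) (Fin (n + 1)) k) : Matrix (Fin (n + 1)) (Fin (n + 1)) k :=
  T.transpose * A * T.map (iterateFrobenius k p e)

theorem map_mulVec (T : Matrix (Fin (n + 1)) (Fin (n + 1)) k) (y : Fin (n + 1) → k) :
    (T.map (iterateFrobenius k p e)).mulVec (fun j => iterateFrobenius k p e (y j))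
      = fun j => iterateFrobenius k p e (T.mulVec y j) := by
  funext i
  simp [Matrix.mulVec, dotProduct]

theorem sesq_qCongr (T A : Matrix (Fin (n + 1)) (Fin (n + 1)) k) (x y : Fin (n + 1) → k) :
    sesq p e (qCongr p e T A) x y = sesq p e A (T.mulVec x) (T.mulVec y) := by
  rw [sesq_eq_dotProduct, sesq_eq_dotProduct, qCongr, ← Matrix.mulVec_mulVec, map_mulVec,
    ← Matrix.mulVec_mulVec, Matrix.dotProduct_mulVec, Matrix.vecMul_transpose]

theorem qCongr_one (A : Matrix (Fin (n + 1)) (Fin (n + 1)) k) : qCongr p e 1 A = A := by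
  simp [qCongr]

theorem qCongr_qCongr (S T A : Matrix (Fin (n + 1)) (Fin (n + 1)) k) :
    qCongr p e S (qCongr p e T A) = qCongr p e (T * S) A := by
  simp only [qCongr, Matrix.transpose_mul, Matrix.map_mul, mul_assoc]

theorem isUnit_map {T : Matrix (Fin (n + 1)) (Fin (n + 1)) k} (hT : IsUnit T) :
    IsUnit (T.map (iterateFrobenius k p e)) :=
  hT.map (iterateFrobenius k p e).mapMatrix

theorem rank_qCongr (T : GL (Fin (n + 1)) k) (A : Matrix (Fin (n + 1)) (Fin (n + 1)) k) :
    (qCongr p e T A).rank = A.rank := by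
  rw [qCongr, Matrix.rank_mul_eq_left_of_isUnit_det, Matrix.rank_mul_eq_right_of_isUnit_det]
  · rw [Matrix.det_transpose]
    exact (Matrix.isUnit_iff_isUnit_det _).mp T.isUnit
  · exact (Matrix.isUnit_iff_isUnit_det _).mp (isUnit_map p e T.isUnit)

/-- The form of `A` is carried to the form of `B` by an invertible substitution. -/
def QCongr (A B : Matrix (Fin (n + 1)) (Fin (n + 1)) k) : Prop :=
  ∃ T : GL (Fin (n + 1)) k, qCongr p e T A = B

end Congruence

/-! ### The model matrices and their rank -/

section Models

variable {k : Type*} [Field k] {n : ℕ}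

theorem W_apply (s i j : Fin (n + 1)) :
    W k n s i j = if (i : ℕ) < s then (if i = j then 1 else 0)
      else if (s : ℕ) ≤ j ∧ (i : ℕ) = j + 1 then 1 else 0 := by
  obtain ⟨i, rfl⟩ := (finSumFinEquiv.trans (finCongr (Nat.add_sub_cancel' s.is_lt.le))).surjective i
  obtain ⟨j, rfl⟩ := (finSumFinEquiv.trans (finCongr (Nat.add_sub_cancel' s.is_lt.le))).surjective j
  rw [W, Matrix.reindex_apply, Matrix.submatrix_apply, Equiv.symm_apply_apply,
    Equiv.symm_apply_apply]
  rcases i with i | i <;> rcases j with j | j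
  · simp [Matrix.one_apply, Fin.ext_iff]
  · have : (i : ℕ) ≠ s + j := by have := i.2; omega
    simp [Fin.ext_iff, this]
  · have : ¬ (s : ℕ) ≤ j := by have := j.2; omega
    simp [this]
  · have h : ((s : ℕ) + i = s + j + 1) ↔ ((i : ℕ) = j + 1) := by omega
    simp [lowerShift, h]

theorem W_mulVec (s : Fin (n + 1)) (z : Fin (n + 1) → k) (i : Fin (n + 1)) :
    (W k n s).mulVec z i = if (i : ℕ) < s then z i else if i = s then 0 else
      z ⟨i - 1, by omega⟩ := by
  rw [Matrix.mulVec, dotProduct]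
  split_ifs with h1 h2
  · rw [Finset.sum_eq_single i]
    · simp [W_apply, h1]
    · intro j _ hj
      simp [W_apply, h1, hj.symm]
    · simp
  · refine Finset.sum_eq_zero fun j _ => ?_
    rw [W_apply, if_neg h1, if_neg (by rw [h2]; omega), zero_mul]
  · have h3 : (i : ℕ) ≠ s := fun h => h2 (Fin.ext h)
    rw [Finset.sum_eq_single ⟨i - 1, by omega⟩]
    · rw [W_apply, if_neg h1, if_pos (by simp only; omega), one_mul]
    · intro j _ hj
      have hj' : (j : ℕ) ≠ i - 1 := fun h => hj (Fin.ext h)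
      rw [W_apply, if_neg h1, if_neg (by omega), zero_mul]
    · simp

theorem W_mulVec_eq_zero_iff (s : Fin (n + 1)) (z : Fin (n + 1) → k) :
    (W k n s).mulVec z = 0 ↔ ∀ i : Fin (n + 1), (i : ℕ) ≠ n → z i = 0 := by
  constructor
  · intro h i hi
    by_cases his : (i : ℕ) < s
    · have := congrFun h i
      rwa [W_mulVec, if_pos his] at this
    · have := congrFun h ⟨i + 1, by omega⟩
      rwa [W_mulVec, if_neg (by simp only; omega),
        if_neg (fun h => by have := congrArg Fin.val h; simp only at this; omega)] at this
  · intro h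
    funext i
    rw [W_mulVec]
    split_ifs with h1 h2
    · exact h i (by omega)
    · rfl
    · have h3 : (i : ℕ) ≠ s := fun h => h2 (Fin.ext h)
      exact h _ (by simp only; omega)

theorem rank_W (s : Fin (n + 1)) : (W k n s).rank = n := by
  have hker : (W k n s).mulVecLin.ker = Submodule.span k {Pi.single (Fin.last n) (1 : k)} := by
    ext z
    rw [LinearMap.mem_ker, Matrix.mulVecLin_apply, W_mulVec_eq_zero_iff,
      Submodule.mem_span_singleton]
    constructor
    · intro h
      refine ⟨z (Fin.last n), funext fun i => ?_⟩
      by_cases hi : i = Fin.last n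
      · subst hi; simp
      · rw [h i fun h => hi (Fin.ext h)]
        simp [hi]
    · rintro ⟨c, rfl⟩ i hi
      have : i ≠ Fin.last n := by rintro rfl; exact hi rfl
      simp [this]
  have h := (W k n s).mulVecLin.finrank_range_add_finrank_ker
  rw [hker, finrank_span_singleton (by simp), Module.finrank_fin_fun] at h
  rw [Matrix.rank]
  omega

end Models

/-! ### Reduction of a rank n matrix to a model -/

section Normal

variable {k : Type*} [Field k] [IsAlgClosed k] (p : ℕ) [Fact p.Prime] [CharP k p] {e : ℕ} {n : ℕ}

/-- Every matrix of rank `n` is `q`-congruent to one of the models `W_s`. -/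
theorem exists_qCongr_W (he : 0 < e) (A : Matrix (Fin (n + 1)) (Fin (n + 1)) k) (hA : A.rank = n) :
    ∃ s : Fin (n + 1), QCongr p e A (W k n s) := by
  choose r hr using iterateFrobenius_surjective (k := k) p e
  have hker : Module.finrank k A.mulVecLin.ker = 1 := by
    have h := A.mulVecLin.finrank_range_add_finrank_ker
    rw [Module.finrank_fin_fun] at h
    rw [Matrix.rank] at hA
    omega
  obtain ⟨z, -, hz⟩ := finrank_eq_one_iff'.mp hker
  have hAz : A.mulVec z = 0 := z.2
  -- The right radical consists of the coordinatewise q-th roots of the kernel of A.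
  obtain ⟨s, d, u, w, h⟩ := exists_isAdapted he (sesq p e A) _ ⊤ rfl (ρ := fun j => r (z.1 j))
    Submodule.mem_top (fun x _ => by
      revert x
      simpa only [Submodule.mem_top, forall_const, sesq_apply_eq_zero_iff, hr] using hAz)
    (fun y _ hy => by
      have hy' := (sesq_apply_eq_zero_iff p e A y).mp fun x => hy x Submodule.mem_top
      obtain ⟨c, hc⟩ := hz ⟨_, hy'⟩
      refine ⟨r c, funext fun j => (iterateFrobenius k p e).injective ?_⟩
      have := congrFun (congrArg Subtype.val hc) j
      simp only [Pi.smul_apply, smul_eq_mul, map_mul, hr]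
      exact this.symm)
  have hcard : s + d = n + 1 := by
    have := h.card
    rwa [finrank_top, Module.finrank_fin_fun] at this
  let f : Fin s ⊕ Fin d → Fin (n + 1) → k := Sum.elim u fun i => w i
  have hf : ∀ i j, sesq p e A (f i) (f j)
      = Matrix.fromBlocks (1 : Matrix (Fin s) (Fin s) k) 0 0 (lowerShift k d) i j := by
    rintro (i | i) (j | j)
    · exact (h.left_left i j).trans (by simp [Matrix.one_apply])
    · exact h.left_right i j j.2
    · exact h.right_left i i.2 j
    · exact (h.right_right i i.2 j j.2).trans (by simp [lowerShift])
  let g : Fin s ⊕ Fin d ≃ Fin (n + 1) := finSumFinEquiv.trans (finCongr hcard)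
  have hspan : ⊤ ≤ Submodule.span k (Set.range (f ∘ g.symm)) := by
    rw [g.symm.surjective.range_comp]
    refine h.le_span.trans (Submodule.span_mono ?_)
    rintro _ (⟨i, rfl⟩ | ⟨i, hi, rfl⟩)
    · exact ⟨Sum.inl i, rfl⟩
    · exact ⟨Sum.inr ⟨i, hi⟩, rfl⟩
  have hind := linearIndependent_of_top_le_span_of_card_eq_finrank hspan (by simp)
  let T : Matrix (Fin (n + 1)) (Fin (n + 1)) k := Matrix.of fun i j => f (g.symm j) i
  have hT : IsUnit T := Matrix.linearIndependent_cols_iff_isUnit.mp hind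
  have hgram : qCongr p e T A = Matrix.reindex g g
      (Matrix.fromBlocks (1 : Matrix (Fin s) (Fin s) k) 0 0 (lowerShift k d)) := by
    ext i j
    have h1 : sesq p e (qCongr p e T A) (Pi.single i 1) (Pi.single j 1) = qCongr p e T A i j :=
      Matrix.toLinearMap₂'Aux_single _ _ _ i j
    rw [← h1, sesq_qCongr, Matrix.reindex_apply, Matrix.submatrix_apply, ← hf,
      Matrix.mulVec_single_one, Matrix.mulVec_single_one]
    rfl
  have hrank : (qCongr p e T A).rank = n := (rank_qCongr p e hT.unit A).trans hA
  -- With d = 0 the matrix would be the identity, of rank n + 1; hence s ≤ n.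
  have hd : d ≠ 0 := by
    rintro rfl
    have h1 : Matrix.fromBlocks (1 : Matrix (Fin s) (Fin s) k) 0 0 (lowerShift k 0) = 1 := by
      rw [← Matrix.fromBlocks_one]
      congr 1
      ext i
      exact i.elim0
    rw [hgram, h1, Matrix.rank_reindex, Matrix.rank_one] at hrank
    simp at hrank
    omega
  obtain rfl : d = n + 1 - s := by omega
  exact ⟨⟨s, by omega⟩, hT.unit, hgram⟩

end Normal

/-! ### Iterated orthogonals distinguish the models -/

section Invariant

variable {k : Type*} [Field k] {V V' : Type*} [AddCommGroup V] [Module k V]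
  [AddCommGroup V'] [Module k V'] {σ : k →+* k}

/-- The iterated right orthogonals of the whole space. -/
def perpChain (b : V →ₗ[k] V →ₛₗ[σ] k) : ℕ → Set V
  | 0 => Set.univ
  | m + 1 => {y | ∀ x ∈ perpChain b m, b x y = 0}

theorem mem_perpChain_of_equiv {b : V →ₗ[k] V →ₛₗ[σ] k} {b' : V' →ₗ[k] V' →ₛₗ[σ] k}
    (g : V' ≃ V) (hg : ∀ x y, b' x y = b (g x) (g y)) (m : ℕ) (y : V') :
    y ∈ perpChain b' m ↔ g y ∈ perpChain b m := by
  induction m generalizing y with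
  | zero => exact iff_of_true trivial trivial
  | succ m ih =>
    change (∀ x ∈ perpChain b' m, b' x y = 0) ↔ ∀ x ∈ perpChain b m, b x (g y) = 0
    rw [← g.forall_congr_right (q := fun x => x ∈ perpChain b m → b x (g y) = 0)]
    simp only [ih, hg]

/-- The left radical lies in the `m`-th iterated right orthogonal. -/
def LeftRadicalLE (b : V →ₗ[k] V →ₛₗ[σ] k) (m : ℕ) : Prop :=
  ∀ x, (∀ y, b x y = 0) → x ∈ perpChain b m

theorem leftRadicalLE_congr {b : V →ₗ[k] V →ₛₗ[σ] k} {b' : V' →ₗ[k] V' →ₛₗ[σ] k}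
    (g : V' ≃ V) (hg : ∀ x y, b' x y = b (g x) (g y)) (m : ℕ) :
    LeftRadicalLE b' m ↔ LeftRadicalLE b m := by
  unfold LeftRadicalLE
  rw [← g.forall_congr_right (q := fun x => (∀ y, b x y = 0) → x ∈ perpChain b m)]
  refine forall_congr' fun x => ?_
  rw [mem_perpChain_of_equiv g hg, ← g.forall_congr_right (q := fun y => b (g x) y = 0)]
  simp only [hg]

/-- The coordinates that do not vanish identically on the `m`-th iterated right orthogonal
of `W_s`. -/
def chainSupport (n s : ℕ) : ℕ → ℕ → Prop
  | 0, _ => True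
  | m + 1, j => if j < s then ¬ chainSupport n s m j else if j < n then
      ¬ chainSupport n s m (j + 1) else True

/-- Counted from the last coordinate, the recursion negates while lowering m and t together, and it
stops with a true value as soon as either reaches 0. -/
theorem chainSupport_sub_iff {n s : ℕ} (hs : s ≤ n) (m t : ℕ) (ht : t ≤ n - s) :
    chainSupport n s m (n - t) ↔ Even (min m t) := by
  induction m generalizing t with
  | zero => simp [chainSupport]
  | succ m ih =>
    rcases t with _ | t
    · simp [chainSupport, hs]
    · rw [chainSupport, if_neg (by omega), if_pos (by omega),
        show n - (t + 1) + 1 = n - t by omega, ih t (by omega), Nat.add_min_add_right,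
        Nat.even_add_one]

variable (p : ℕ) [Fact p.Prime] [CharP k p] (e : ℕ) {n : ℕ}

/-- Each term is a coordinate subspace: pairing with e_i on the left gives y_i^q for i < s, 0 for i
= s and y_(i-1)^q for i > s. The coordinate y_n is never constrained once m > 0. -/
theorem mem_perpChain_W_iff (s : Fin (n + 1)) (m : ℕ) (y : Fin (n + 1) → k) :
    y ∈ perpChain (sesq p e (W k n s)) m ↔
      ∀ j : Fin (n + 1), ¬ chainSupport n s m j → y j = 0 := by
  have hq0 : ∀ c : k, iterateFrobenius k p e c = 0 ↔ c = 0 := fun c =>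
    map_eq_zero (iterateFrobenius k p e)
  induction m generalizing y with
  | zero => exact iff_of_true trivial fun j hj => absurd trivial hj
  | succ m ih =>
    have h1 : y ∈ perpChain (sesq p e (W k n s)) (m + 1) ↔ ∀ i : Fin (n + 1),
        chainSupport n s m i → (W k n s).mulVec (fun j => iterateFrobenius k p e (y j)) i = 0 := by
      change (∀ x ∈ perpChain _ m, _ = 0) ↔ _
      simp only [ih, sesq_eq_dotProduct]
      constructor
      · intro h i hi
        refine (single_one_dotProduct i _).symm.trans (h _ fun j hj => ?_)
        rw [Pi.single_eq_of_ne]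
        rintro rfl
        exact hj hi
      · intro h x hx
        refine Finset.sum_eq_zero fun i _ => ?_
        by_cases hi : chainSupport n s m i
        · rw [h i hi, mul_zero]
        · rw [hx i hi, zero_mul]
    rw [h1]
    simp only [W_mulVec, chainSupport]
    constructor
    · intro h j hj
      split_ifs at hj with h2 h3
      · have := h j (not_not.mp hj)
        rwa [if_pos h2, hq0] at this
      · have := h ⟨j + 1, by omega⟩ (not_not.mp hj)
        rwa [if_neg (by simp only; omega), if_neg (fun h => by
          have := congrArg Fin.val h; simp only at this; omega), hq0] at this
      · exact absurd trivial hj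
    · intro h i hi
      split_ifs with h2 h3
      · rw [hq0]
        exact h i (by rw [if_pos h2]; exact not_not.mpr hi)
      · rfl
      · have h4 : (i : ℕ) ≠ s := fun h => h3 (Fin.ext h)
        rw [hq0]
        refine h _ ?_
        rw [if_neg (by simp only; omega), if_pos (by simp only; omega), not_not]
        rwa [show (i : ℕ) - 1 + 1 = i by omega]

/-- Row s of W_s is zero and the left radical is the line of e_s, so the question is whether
coordinate s = n - (n - s) is in the support. -/
theorem leftRadicalLE_W_iff (s : Fin (n + 1)) (m : ℕ) :
    LeftRadicalLE (sesq p e (W k n s)) m ↔ Even (min m (n - s)) := by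
  have hs : (s : ℕ) ≤ n := by omega
  rw [← chainSupport_sub_iff hs m (n - s) le_rfl, show n - (n - (s : ℕ)) = s by omega]
  simp only [LeftRadicalLE, mem_perpChain_W_iff]
  constructor
  · intro h
    by_contra hns
    have := h (Pi.single s 1) (fun y => by
      rw [sesq_eq_dotProduct, single_one_dotProduct, W_mulVec, if_neg (lt_irrefl _), if_pos rfl])
      s hns
    simp at this
  · intro h x hx j hj
    have hjs : (j : ℕ) ≠ s := fun h' => hj (h' ▸ h)
    -- Every e_j with j ≠ s is a column of W_s, so b(x, e_l) = x_j for some l.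
    have key : ∃ l : Fin (n + 1), ∀ i, W k n s i l = if i = j then 1 else 0 := by
      by_cases hlt : (j : ℕ) < s
      · refine ⟨j, fun i => ?_⟩
        rw [W_apply]
        by_cases hij : i = j
        · rw [hij, if_pos hlt]
        · split_ifs <;> first | rfl | omega
      · refine ⟨⟨j - 1, by omega⟩, fun i => ?_⟩
        rw [W_apply]
        by_cases hij : i = j
        · rw [hij, if_neg hlt, if_pos (by simp only; omega), if_pos rfl]
        · have hij' : (i : ℕ) ≠ j := fun h => hij (Fin.ext h)
          rw [if_neg hij]
          split_ifs with h1 h2 h3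
          · have := congrArg Fin.val h2
            simp only at this
            omega
          · rfl
          · simp only at h3
            omega
          · rfl
    obtain ⟨l, hl⟩ := key
    have h1 := hx (Pi.single l 1)
    have h2 : ∀ i, (W k n s).mulVec (fun j => iterateFrobenius k p e
        ((Pi.single l 1 : Fin (n + 1) → k) j)) i = if i = j then 1 else 0 := by
      intro i
      rw [← hl, Matrix.mulVec, dotProduct, Finset.sum_eq_single l]
      · simp
      · intro j _ hj
        simp [hj]
      · simp
    rw [sesq_eq_dotProduct, dotProduct] at h1
    simpa [h2] using h1

/-- Distinct models are not `q`-congruent. -/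
theorem eq_of_qCongr_W {s s' : Fin (n + 1)} (h : QCongr p e (W k n s) (W k n s')) : s = s' := by
  obtain ⟨T, hT⟩ := h
  let g : (Fin (n + 1) → k) ≃ (Fin (n + 1) → k) :=
    { toFun := T.1.mulVec
      invFun := (T⁻¹).1.mulVec
      left_inv := fun x => by
        rw [Matrix.mulVec_mulVec, ← Units.val_mul, inv_mul_cancel, Units.val_one, Matrix.one_mulVec]
      right_inv := fun x => by
        rw [Matrix.mulVec_mulVec, ← Units.val_mul, mul_inv_cancel, Units.val_one,
          Matrix.one_mulVec] }
  have hiff : ∀ m, Even (min m (n - (s' : ℕ))) ↔ Even (min m (n - (s : ℕ))) := by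
    intro m
    rw [← leftRadicalLE_W_iff (k := k) p e s', ← leftRadicalLE_W_iff (k := k) p e s, ← hT]
    exact leftRadicalLE_congr g (fun x y => sesq_qCongr p e T _ x y) m
  by_contra hne
  have hne' : (s : ℕ) ≠ s' := fun h => hne (Fin.ext h)
  -- One step past the smaller of n - s and n - s', one minimum has stabilized and the other has
  -- just grown by one, so the parities differ.
  rcases Nat.lt_or_ge (n - (s : ℕ)) (n - s') with hlt | hge
  · have := hiff (n - (s : ℕ) + 1)
    rw [min_eq_left (by omega), min_eq_right (by omega), Nat.even_add_one] at this
    exact (not_iff_self this)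
  · have := hiff (n - (s' : ℕ) + 1)
    rw [min_eq_right (by omega), min_eq_left (by omega), Nat.even_add_one] at this
    exact (iff_not_self this)

end Invariant

/-! ### q-congruence as an equivalence, and scalars -/

section Congruence

variable {k : Type*} [Field k] (p : ℕ) [Fact p.Prime] [CharP k p] (e : ℕ) {n : ℕ}

variable {p e} in
theorem QCongr.symm {A B : Matrix (Fin (n + 1)) (Fin (n + 1)) k} (h : QCongr p e A B) :
    QCongr p e B A := by
  obtain ⟨T, rfl⟩ := h
  exact ⟨T⁻¹, by rw [qCongr_qCongr, ← Units.val_mul, mul_inv_cancel, Units.val_one, qCongr_one]⟩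

variable {p e} in
theorem QCongr.trans {A B C : Matrix (Fin (n + 1)) (Fin (n + 1)) k} (h : QCongr p e A B)
    (h' : QCongr p e B C) : QCongr p e A C := by
  obtain ⟨T, rfl⟩ := h
  obtain ⟨S, rfl⟩ := h'
  exact ⟨T * S, by rw [qCongr_qCongr, Units.val_mul]⟩

/-- The scalar substitution l multiplies the form by l^(q+1), and k contains a (q+1)-th root of c.
-/
theorem qCongr_smul [IsAlgClosed k] (A : Matrix (Fin (n + 1)) (Fin (n + 1)) k) {c : k}
    (hc : c ≠ 0) : QCongr p e A (c • A) := by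
  obtain ⟨l, rfl⟩ := IsAlgClosed.exists_pow_nat_eq c (n := p ^ e + 1) (by omega)
  have hl : l ≠ 0 := fun h => hc (by rw [h, zero_pow (by omega)])
  refine ⟨((IsUnit.mk0 l hl).map (algebraMap k (Matrix (Fin (n + 1)) (Fin (n + 1)) k))).unit, ?_⟩
  ext i j
  have h1 : ((algebraMap k (Matrix (Fin (n + 1)) (Fin (n + 1)) k) l).map
      (iterateFrobenius k p e)) = (l ^ p ^ e) • 1 := by
    rw [← iterateFrobenius_def, Algebra.algebraMap_eq_smul_one]
    ext i j
    by_cases h : i = j <;> simp [h]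
  rw [IsUnit.unit_spec, qCongr, h1, Algebra.algebraMap_eq_smul_one]
  simp [pow_succ]
  ring

end Congruence

/-! ### Equations, ideals and changes of coordinates -/

section Forms

variable {k : Type*} [Field k] {n : ℕ}

theorem eval_form (q : ℕ) (A : Matrix (Fin (n + 1)) (Fin (n + 1)) k) (x : Fin (n + 1) → k) :
    MvPolynomial.eval x (form q A) = ∑ i, ∑ j, A i j * x i * x j ^ q := by
  simp [form]

theorem eval_changeCoords (T : Matrix (Fin (n + 1)) (Fin (n + 1)) k) (x : Fin (n + 1) → k)
    (F : MvPolynomial (Fin (n + 1)) k) :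
    MvPolynomial.eval x (changeCoords T F) = MvPolynomial.eval (T.mulVec x) F := by
  induction F using MvPolynomial.induction_on with
  | C a => simp [changeCoords]
  | add F G hF hG => rw [map_add, map_add, map_add, hF, hG]
  | mul_X F i hF =>
    rw [map_mul, map_mul, map_mul, hF]
    simp [changeCoords, Matrix.mulVec, dotProduct]

theorem changeCoords_changeCoords [Infinite k] (S T : Matrix (Fin (n + 1)) (Fin (n + 1)) k)
    (F : MvPolynomial (Fin (n + 1)) k) :
    changeCoords S (changeCoords T F) = changeCoords (T * S) F :=
  MvPolynomial.funext fun x => by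
    rw [eval_changeCoords, eval_changeCoords, eval_changeCoords, Matrix.mulVec_mulVec]

theorem changeCoords_one [Infinite k] (F : MvPolynomial (Fin (n + 1)) k) :
    changeCoords 1 F = F :=
  MvPolynomial.funext fun x => by rw [eval_changeCoords, Matrix.one_mulVec]

theorem form_smul (q : ℕ) (c : k) (A : Matrix (Fin (n + 1)) (Fin (n + 1)) k) :
    form q (c • A) = MvPolynomial.C c * form q A := by
  simp [form, Finset.mul_sum, mul_assoc]

theorem coeff_form {q : ℕ} (hq : 1 < q) (A : Matrix (Fin (n + 1)) (Fin (n + 1)) k)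
    (i j : Fin (n + 1)) :
    (form q A).coeff (Finsupp.single i 1 + Finsupp.single j q) = A i j := by
  classical
  have hmon : ∀ a b, MvPolynomial.C (A a b) * MvPolynomial.X a * MvPolynomial.X b ^ q
      = MvPolynomial.monomial (Finsupp.single a 1 + Finsupp.single b q) (A a b) := by
    intro a b
    rw [MvPolynomial.X_pow_eq_monomial, MvPolynomial.C_mul_X_eq_monomial,
      MvPolynomial.monomial_mul, mul_one]
  have hinj : ∀ a b, Finsupp.single a 1 + Finsupp.single b q
      = (Finsupp.single i 1 + Finsupp.single j q : Fin (n + 1) →₀ ℕ) → a = i ∧ b = j := by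
    intro a b h
    -- The exponent of x_j would be at most 1 on one side and at least q > 1 on the other.
    have hb : b = j := by
      by_contra hb
      have := DFunLike.congr_fun h j
      simp only [Finsupp.add_apply, Finsupp.single_apply, if_neg hb, if_true] at this
      split_ifs at this <;> omega
    subst hb
    exact ⟨Finsupp.single_left_injective one_ne_zero (add_right_cancel h), rfl⟩
  simp only [form, hmon, MvPolynomial.coeff_sum, MvPolynomial.coeff_monomial]
  rw [Finset.sum_eq_single i, Finset.sum_eq_single j, if_pos rfl]
  · intro b _ hb
    exact if_neg fun h => hb (hinj _ _ h).2
  · simp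
  · intro a _ ha
    exact Finset.sum_eq_zero fun b _ => if_neg fun h => ha (hinj _ _ h).1
  · simp

theorem form_injective {q : ℕ} (hq : 1 < q) : Function.Injective (form (k := k) (n := n) q) := by
  intro A B h
  ext i j
  rw [← coeff_form hq A, h, coeff_form hq B]

theorem totalDegree_linear_le (c : Fin (n + 1) → k) :
    (∑ j, MvPolynomial.C (c j) * MvPolynomial.X j : MvPolynomial (Fin (n + 1)) k).totalDegree
      ≤ 1 := by
  refine (MvPolynomial.totalDegree_finsetSum_le fun j _ => ?_)
  refine (MvPolynomial.totalDegree_mul _ _).trans ?_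
  simp

theorem coeff_linear (c : Fin (n + 1) → k) (j : Fin (n + 1)) :
    (∑ j, MvPolynomial.C (c j) * MvPolynomial.X j : MvPolynomial (Fin (n + 1)) k).coeff
      (Finsupp.single j 1) = c j := by
  classical
  simp only [MvPolynomial.coeff_sum, MvPolynomial.coeff_C_mul, MvPolynomial.coeff_X]
  rw [Finset.sum_eq_single j]
  · simp
  · intro b _ hb
    rw [if_neg fun h => hb (Finsupp.single_left_injective one_ne_zero h), mul_zero]
  · simp

variable (p : ℕ) [Fact p.Prime] [CharP k p] (e : ℕ)

theorem eval_form_eq_sesq (A : Matrix (Fin (n + 1)) (Fin (n + 1)) k) (x : Fin (n + 1) → k) :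
    MvPolynomial.eval x (form (p ^ e) A) = sesq p e A x x := by
  rw [eval_form, sesq_apply]

theorem changeCoords_form [Infinite k] (T A : Matrix (Fin (n + 1)) (Fin (n + 1)) k) :
    changeCoords T (form (p ^ e) A) = form (p ^ e) (qCongr p e T A) :=
  MvPolynomial.funext fun x => by
    rw [eval_changeCoords, eval_form_eq_sesq, eval_form_eq_sesq, sesq_qCongr]

variable {p e} [IsAlgClosed k]

theorem qCongr_of_associated (he : 0 < e) {A B : Matrix (Fin (n + 1)) (Fin (n + 1)) k}
    (h : Associated (form (p ^ e) A) (form (p ^ e) B)) : QCongr p e A B := by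
  obtain ⟨u, hu⟩ := h
  obtain ⟨c, hc, hcu⟩ := MvPolynomial.isUnit_iff_eq_C_of_isReduced.mp u.isUnit
  rw [hcu, mul_comm, ← form_smul] at hu
  rw [← form_injective (Nat.one_lt_pow he.ne' (Fact.out : p.Prime).one_lt) hu]
  exact qCongr_smul p e A hc.ne_zero

theorem schemeProjIso_iff (he : 0 < e) (A B : Matrix (Fin (n + 1)) (Fin (n + 1)) k) :
    SchemeProjIso (hypersurfaceIdeal (p ^ e) A) (hypersurfaceIdeal (p ^ e) B) ↔ QCongr p e A B := by
  have hmap : ∀ T : GL (Fin (n + 1)) k, (hypersurfaceIdeal (p ^ e) A).map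
      (changeCoords (T : Matrix (Fin (n + 1)) (Fin (n + 1)) k))
        = hypersurfaceIdeal (p ^ e) (qCongr p e T A) := fun T => by
    rw [hypersurfaceIdeal, Ideal.map_span, Set.image_singleton, changeCoords_form,
      hypersurfaceIdeal]
  constructor
  · rintro ⟨T, hT⟩
    rw [hmap] at hT
    exact QCongr.trans ⟨T, rfl⟩
      (qCongr_of_associated he (Ideal.span_singleton_eq_span_singleton.mp hT))
  · rintro ⟨T, rfl⟩
    exact ⟨T, hmap T⟩

theorem schemeProjIso_equivalence :
    Equivalence (SchemeProjIso (k := k) (n := n)) where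
  refl I := ⟨1, by
    have h : changeCoords (1 : Matrix (Fin (n + 1)) (Fin (n + 1)) k) = AlgHom.id k _ :=
      AlgHom.ext changeCoords_one
    rw [Units.val_one, h]
    exact Ideal.map_id I⟩
  symm := by
    rintro I _ ⟨T, rfl⟩
    refine ⟨T⁻¹, ?_⟩
    rw [Ideal.map_mapₐ]
    have h : (changeCoords (T⁻¹).1).comp (changeCoords T.1) = AlgHom.id k _ :=
      AlgHom.ext fun F => by
        rw [AlgHom.comp_apply, changeCoords_changeCoords, ← Units.val_mul, mul_inv_cancel,
          Units.val_one, changeCoords_one, AlgHom.id_apply]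
    rw [h]
    exact Ideal.map_id I
  trans := by
    rintro I _ _ ⟨T, rfl⟩ ⟨S, rfl⟩
    refine ⟨T * S, ?_⟩
    rw [Ideal.map_mapₐ]
    have h : (changeCoords S.1).comp (changeCoords T.1) = changeCoords (T * S).1 :=
      AlgHom.ext fun F => by
        rw [AlgHom.comp_apply, changeCoords_changeCoords, ← Units.val_mul]
    rw [h]

end Forms

/-! ### Squarefree equations and the Nullstellensatz -/

section Squarefree

variable {k : Type*} [Field k] [IsAlgClosed k] {p : ℕ} [Fact p.Prime] [CharP k p] {e : ℕ} {n : ℕ}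

/-- The partial derivatives of the form are `q`-th powers of linear forms. -/
theorem exists_pderiv_form (he : 0 < e) (A : Matrix (Fin (n + 1)) (Fin (n + 1)) k) :
    ∃ R : Matrix (Fin (n + 1)) (Fin (n + 1)) k, (∀ i j, R i j ^ p ^ e = A i j) ∧
      ∀ i, MvPolynomial.pderiv i (form (p ^ e) A)
        = (∑ j, MvPolynomial.C (R i j) * MvPolynomial.X j) ^ p ^ e := by
  choose r hr using iterateFrobenius_surjective (k := k) p e
  simp only [iterateFrobenius_def] at hr
  refine ⟨A.map r, fun i j => hr _, fun i => ?_⟩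
  rw [sum_pow_char_pow]
  simp only [form, map_sum, Derivation.leibniz, Derivation.leibniz_pow, MvPolynomial.pderiv_C,
    MvPolynomial.pderiv_X, smul_eq_mul, mul_pow, ← MvPolynomial.C_pow,
    Matrix.map_apply, hr]
  rw [Finset.sum_eq_single i]
  · refine Finset.sum_congr rfl fun j _ => ?_
    simp [he.ne', mul_comm]
  · intro a _ ha
    refine Finset.sum_eq_zero fun j _ => ?_
    simp [he.ne', ha]
  · simp

theorem squarefree_form (he : 0 < e) (A : Matrix (Fin (n + 1)) (Fin (n + 1)) k)
    (hA : 2 ≤ A.rank) : Squarefree (form (p ^ e) A) := by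
  have hQ : 1 < p ^ e := Nat.one_lt_pow he.ne' (Fact.out : p.Prime).one_lt
  obtain ⟨R, hR, hderiv⟩ := exists_pderiv_form (p := p) he A
  have hA0 : A ≠ 0 := by rintro rfl; simp at hA
  have hF0 : form (p ^ e) A ≠ 0 := fun h => hA0 (form_injective hQ (h.trans (by simp [form])))
  intro g hg
  by_contra hgu
  have hg0 : g ≠ 0 := by
    rintro rfl
    rw [zero_mul, zero_dvd_iff] at hg
    exact hF0 hg
  obtain ⟨π, hπ, hπg⟩ := WfDvdMonoid.exists_irreducible_factor hgu hg0
  obtain ⟨G, hG⟩ := (mul_dvd_mul hπg hπg).trans hg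
  -- A repeated prime factor divides every partial derivative, hence the linear forms of which these
  -- are q-th powers.
  have hdvd : ∀ i, π ∣ ∑ j, MvPolynomial.C (R i j) * MvPolynomial.X j := by
    intro i
    refine hπ.prime.dvd_of_dvd_pow (n := p ^ e) ?_
    rw [← hderiv, hG, Derivation.leibniz, Derivation.leibniz]
    simp only [smul_eq_mul]
    exact dvd_add (dvd_mul_of_dvd_left (dvd_mul_right _ _) _)
      (dvd_mul_of_dvd_right (dvd_add (dvd_mul_right _ _) (dvd_mul_right _ _)) _)
  have hπdeg : 1 ≤ π.totalDegree := by
    rw [Nat.one_le_iff_ne_zero]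
    intro h0
    rw [MvPolynomial.totalDegree_eq_zero_iff_eq_C] at h0
    have hc : π.coeff 0 ≠ 0 := by
      intro hc
      rw [hc, map_zero] at h0
      exact hπ.ne_zero h0
    exact hπ.not_isUnit (h0 ▸ (IsUnit.mk0 _ hc).map MvPolynomial.C)
  -- A nonconstant divisor of a nonzero linear form has constant cofactor. So all rows of R are
  -- multiples of the linear part of π, and A has rank at most one.
  have hconst : ∀ i, ∃ c : k, ∀ j, R i j = π.coeff (Finsupp.single j 1) * c := by
    intro i
    obtain ⟨h, hh⟩ := hdvd i
    by_cases h0 : h = 0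
    · refine ⟨0, fun j => ?_⟩
      rw [← coeff_linear (R i) j, hh, h0, mul_zero, mul_zero, MvPolynomial.coeff_zero]
    · have hdeg := totalDegree_linear_le (R i)
      rw [hh, MvPolynomial.totalDegree_mul_of_isDomain hπ.ne_zero h0] at hdeg
      have hC := MvPolynomial.totalDegree_eq_zero_iff_eq_C.mp (by omega : h.totalDegree = 0)
      refine ⟨h.coeff 0, fun j => ?_⟩
      rw [← coeff_linear (R i) j, hh]
      conv_lhs => rw [hC, mul_comm, MvPolynomial.coeff_C_mul, mul_comm]
  choose c hc using hconst
  have hvec : A = Matrix.vecMulVec (fun i => c i ^ p ^ e)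
      fun j => π.coeff (Finsupp.single j 1) ^ p ^ e := by
    ext i j
    rw [← hR, hc, mul_pow, Matrix.vecMulVec_apply, mul_comm]
  have := Matrix.rank_vecMulVec_le (fun i => c i ^ p ^ e)
    fun j => π.coeff (Finsupp.single j 1) ^ p ^ e
  rw [← hvec] at this
  omega

/-- A squarefree polynomial divides every polynomial that vanishes on its zeros. -/
theorem dvd_of_forall_eval_eq_zero {F G : MvPolynomial (Fin (n + 1)) k} (hF : Squarefree F)
    (h : ∀ x, MvPolynomial.eval x F = 0 → MvPolynomial.eval x G = 0) : F ∣ G := by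
  have hG : G ∈ (Ideal.span {F}).radical := by
    rw [← MvPolynomial.vanishingIdeal_zeroLocus_eq_radical (K := k)]
    intro x hx
    have := hx F (Ideal.mem_span_singleton_self F)
    rw [MvPolynomial.aeval_eq_eval] at this ⊢
    exact h x this
  obtain ⟨m, hm⟩ := hG
  rw [Ideal.mem_span_singleton] at hm
  rcases m with _ | m
  · exact (isUnit_of_dvd_one (by simpa using hm)).dvd
  · exact (hF.dvd_pow_iff_dvd (by omega)).mp hm

/-- Forms of rank at least two with the same zeros are `q`-congruent. -/
theorem qCongr_of_forall_eval_eq_zero_iff (he : 0 < e)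
    {A B : Matrix (Fin (n + 1)) (Fin (n + 1)) k} (hA : 2 ≤ A.rank) (hB : 2 ≤ B.rank)
    (h : ∀ x, sesq p e A x x = 0 ↔ sesq p e B x x = 0) : QCongr p e A B := by
  simp only [← eval_form_eq_sesq] at h
  exact qCongr_of_associated he (associated_of_dvd_dvd
    (dvd_of_forall_eval_eq_zero (squarefree_form he A hA) fun x => (h x).mp)
    (dvd_of_forall_eval_eq_zero (squarefree_form he B hB) fun x => (h x).mpr))

end Squarefree

/-! ### Projective isomorphism of point sets -/

section Points

variable {k : Type*} [Field k] {n : ℕ}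

theorem pointProjIso_equivalence : Equivalence (PointProjIso (k := k) (n := n)) where
  refl X := ⟨LinearEquiv.refl k _, by
    have : (Projectivization.map (LinearEquiv.refl k (Fin (n + 1) → k)).toLinearMap
        (LinearEquiv.refl k (Fin (n + 1) → k)).injective) = id := Projectivization.map_id
    rw [this, Set.image_id]⟩
  symm := by
    rintro X _ ⟨g, rfl⟩
    refine ⟨g.symm, ?_⟩
    rw [Set.image_image]
    convert Set.image_id' X with P
    induction P using Projectivization.ind with
    | h v hv => simp [Projectivization.map_mk]
  trans := by
    rintro X _ _ ⟨g, rfl⟩ ⟨g', rfl⟩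
    refine ⟨g.trans g', ?_⟩
    rw [Set.image_image]
    congr 1
    funext P
    induction P using Projectivization.ind with
    | h v hv => simp [Projectivization.map_mk]

variable (p : ℕ) [Fact p.Prime] [CharP k p] (e : ℕ)

theorem pointProjIso_iff (A B : Matrix (Fin (n + 1)) (Fin (n + 1)) k) :
    PointProjIso (hypersurfacePoints (p ^ e) A) (hypersurfacePoints (p ^ e) B) ↔
      ∃ g : (Fin (n + 1) → k) ≃ₗ[k] (Fin (n + 1) → k),
        ∀ x, sesq p e A x x = 0 ↔ sesq p e B (g x) (g x) = 0 := by
  refine exists_congr fun g => ?_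
  have hinj := Projectivization.map_injective g.toLinearMap g.injective
  constructor
  · intro h x
    by_cases hx : x = 0
    · simp [hx]
    · have hgx : g x ≠ 0 := by simpa using hx
      rw [sesq_apply, sesq_apply, ← mk_mem_hypersurfacePoints _ A x hx,
        ← mk_mem_hypersurfacePoints _ B (g x) hgx, ← h, ← hinj.mem_set_image]
      rfl
  · intro h
    have hmem : ∀ P, P ∈ hypersurfacePoints (p ^ e) A ↔
        Projectivization.map g.toLinearMap g.injective P ∈ hypersurfacePoints (p ^ e) B := by
      intro P
      induction P using Projectivization.ind with
      | h x hx =>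
        have hgx : g x ≠ 0 := by simpa using hx
        have h1 := h x
        rw [sesq_apply, sesq_apply, ← mk_mem_hypersurfacePoints _ A x hx,
          ← mk_mem_hypersurfacePoints _ B (g x) hgx] at h1
        exact h1
    ext P
    constructor
    · rintro ⟨Q, hQ, rfl⟩
      exact (hmem Q).mp hQ
    · intro hP
      refine ⟨Projectivization.map g.symm.toLinearMap g.symm.injective P, ?_⟩
      have hP' : Projectivization.map g.toLinearMap g.injective
          (Projectivization.map g.symm.toLinearMap g.symm.injective P) = P := by
        induction P using Projectivization.ind with
        | h v hv => simp [Projectivization.map_mk]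
      exact ⟨(hmem _).mpr (by rwa [hP']), hP'⟩

variable {p e}

theorem QCongr.pointProjIso {A B : Matrix (Fin (n + 1)) (Fin (n + 1)) k} (h : QCongr p e A B) :
    PointProjIso (hypersurfacePoints (p ^ e) A) (hypersurfacePoints (p ^ e) B) := by
  obtain ⟨T, rfl⟩ := h
  -- T carries the zeros of the transformed form to those of A, hence the passage to the inverse.
  refine pointProjIso_equivalence.symm ((pointProjIso_iff p e _ _).mpr
    ⟨Matrix.toLin'OfInv (M := (T⁻¹).1) (M' := T.1) ?_ ?_, fun x => ?_⟩)
  · rw [← Units.val_mul, inv_mul_cancel, Units.val_one]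
  · rw [← Units.val_mul, mul_inv_cancel, Units.val_one]
  · rw [sesq_qCongr]
    simp [Matrix.toLin'OfInv]

theorem qCongr_of_pointProjIso [IsAlgClosed k] (he : 0 < e)
    {A B : Matrix (Fin (n + 1)) (Fin (n + 1)) k} (hA : 2 ≤ A.rank) (hB : 2 ≤ B.rank)
    (h : PointProjIso (hypersurfacePoints (p ^ e) A) (hypersurfacePoints (p ^ e) B)) :
    QCongr p e A B := by
  obtain ⟨g, hg⟩ := (pointProjIso_iff p e A B).mp h
  have hT : IsUnit (LinearMap.toMatrix' g.toLinearMap) :=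
    LinearMap.isUnit_toMatrix'_iff.mpr ((Module.End.isUnit_iff _).mpr g.bijective)
  have hrank := rank_qCongr p e hT.unit B
  have h1 : QCongr p e A (qCongr p e hT.unit B) := by
    refine qCongr_of_forall_eval_eq_zero_iff he hA (hrank ▸ hB) fun x => ?_
    rw [hg, sesq_qCongr, IsUnit.unit_spec, LinearMap.toMatrix'_mulVec]
    rfl
  exact h1.trans (QCongr.symm ⟨hT.unit, rfl⟩)

/-- On the projective line the two models have different numbers of points. -/
theorem not_pointProjIso_W_of_line :
    ¬ PointProjIso (hypersurfacePoints (p ^ e) (W k 1 0))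
      (hypersurfacePoints (p ^ e) (W k 1 1)) := by
  intro h
  have hq : p ^ e ≠ 0 := pow_ne_zero _ (Fact.out : p.Prime).ne_zero
  obtain ⟨g, hg⟩ := (pointProjIso_iff p e _ _).mp h
  have h0 : ∀ x, sesq p e (W k 1 0) x x = x 1 * x 0 ^ p ^ e := fun x => by
    simp [sesq_apply, W_apply, Fin.sum_univ_two]
  have h1 : ∀ x, sesq p e (W k 1 1) x x = x 0 * x 0 ^ p ^ e := fun x => by
    simp [sesq_apply, W_apply, Fin.sum_univ_two]
  -- Both coordinate points lie on x_1 x_0^q = 0, whereas x_0^(q+1) = 0 forces x_0 = 0. So g would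
  -- map the whole plane into a line.
  have hzero : ∀ i, g (Pi.single i 1) 0 = 0 := by
    intro i
    have h2 := (hg (Pi.single i 1)).mp (by
      rw [h0]
      fin_cases i <;> simp [zero_pow hq])
    rw [h1, ← pow_succ'] at h2
    exact pow_eq_zero_iff (by omega) |>.mp h2
  obtain ⟨x, hx⟩ := g.surjective (Pi.single 0 1)
  have h3 : g x 0 = 0 := by
    have hdec : x = x 0 • Pi.single 0 1 + x 1 • Pi.single 1 1 := by
      funext i
      fin_cases i <;> simp
    rw [hdec, map_add, map_smul, map_smul, Pi.add_apply, Pi.smul_apply, Pi.smul_apply, hzero,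
      hzero, smul_zero, smul_zero, add_zero]
  rw [hx] at h3
  simp at h3

/-- For n ≥ 2 the rank n is large enough to recover the equations from the points. For n = 1 both
equations have multiple factors, and the explicit comparison on the line is used instead. -/
theorem eq_of_pointProjIso_W [IsAlgClosed k] (he : 0 < e) (hn : 0 < n) {s s' : Fin (n + 1)}
    (h : PointProjIso (hypersurfacePoints (p ^ e) (W k n s))
      (hypersurfacePoints (p ^ e) (W k n s'))) : s = s' := by
  rcases Nat.lt_or_ge 1 n with h2 | h2
  · exact eq_of_qCongr_W (k := k) p e
      (qCongr_of_pointProjIso he (by rwa [rank_W]) (by rwa [rank_W]) h)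
  · obtain rfl : n = 1 := by omega
    have h01 := not_pointProjIso_W_of_line (k := k) (p := p) (e := e)
    fin_cases s <;> fin_cases s'
    · rfl
    · exact absurd h h01
    · exact absurd (pointProjIso_equivalence.symm h) h01
    · rfl

end Points

/-! ### Counting classes by representatives -/

section Counting

/-- Representatives of the equivalence classes that meet the image of a map count these classes. -/
theorem existsUnique_and_ncard_classes {X M : Type*} {R : X → X → Prop} (hR : Equivalence R)
    (f : M → X) (P : M → Prop) {N : ℕ} (w : Fin N → M) (hw : ∀ s, P (w s))
    (hex : ∀ A, P A → ∃ s, R (f A) (f (w s)))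
    (huniq : ∀ s s', R (f (w s)) (f (w s')) → s = s') :
    (∀ A, P A → ∃! s, R (f A) (f (w s))) ∧
      {C : Set X | ∃ A, P A ∧ C = {J | R (f A) J}}.ncard = N := by
  refine ⟨fun A hA => ?_, ?_⟩
  · obtain ⟨s, hs⟩ := hex A hA
    exact ⟨s, hs, fun s' hs' => huniq _ _ (hR.trans (hR.symm hs') hs)⟩
  · have hrange : {C : Set X | ∃ A, P A ∧ C = {J | R (f A) J}}
        = (fun s => {J | R (f (w s)) J}) '' Set.univ := by
      ext C
      constructor
      · rintro ⟨A, hA, rfl⟩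
        obtain ⟨s, hs⟩ := hex A hA
        refine ⟨s, trivial, Set.ext fun J => ?_⟩
        exact ⟨fun h => hR.trans hs h, fun h => hR.trans (hR.symm hs) h⟩
      · rintro ⟨s, -, rfl⟩
        exact ⟨w s, hw s, rfl⟩
    have hinj : Function.Injective fun s => {J | R (f (w s)) J} := fun s s' h =>
      huniq s s' ((Set.ext_iff.mp h (f (w s'))).mpr (hR.refl _))
    rw [hrange, Set.ncard_image_of_injective _ hinj, Set.ncard_univ, Nat.card_fin]

end Counting

end QForm

end

theorem theorem1p2 {k : Type*} [Field k] [IsAlgClosed k] (p : ℕ) [Fact p.Prime] [CharP k p]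
    (e : ℕ) (he : 0 < e) (q : ℕ) (hq : q = p ^ e) (n : ℕ) (hn : 0 < n) :
    -- the model matrices have rank `n`
    (∀ s : Fin (n + 1), (QForm.W k n s).rank = n) ∧
    -- every `X_A` with `A` of rank `n` is projectively isomorphic to exactly one `X_s`
    (∀ A : Matrix (Fin (n + 1)) (Fin (n + 1)) k, A.rank = n →
      (∃! s : Fin (n + 1), QForm.SchemeProjIso
        (QForm.hypersurfaceIdeal q A) (QForm.hypersurfaceIdeal q (QForm.W k n s))) ∧
      (∃! s : Fin (n + 1), QForm.PointProjIso
        (QForm.hypersurfacePoints q A) (QForm.hypersurfacePoints q (QForm.W k n s)))) ∧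
    -- distinct `s` give hypersurfaces that are not projectively isomorphic
    (∀ s s' : Fin (n + 1), s ≠ s' →
      ¬ QForm.SchemeProjIso (QForm.hypersurfaceIdeal q (QForm.W k n s))
        (QForm.hypersurfaceIdeal q (QForm.W k n s')) ∧
      ¬ QForm.PointProjIso (QForm.hypersurfacePoints q (QForm.W k n s))
        (QForm.hypersurfacePoints q (QForm.W k n s'))) ∧
    -- there are exactly `n + 1` projective isomorphism classes
    {C : Set (Ideal (MvPolynomial (Fin (n + 1)) k)) |
      ∃ A : Matrix (Fin (n + 1)) (Fin (n + 1)) k, A.rank = n ∧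
        C = {J | QForm.SchemeProjIso (QForm.hypersurfaceIdeal q A) J}}.ncard = n + 1 ∧
    {C : Set (Set (Projectivization k (Fin (n + 1) → k))) |
      ∃ A : Matrix (Fin (n + 1)) (Fin (n + 1)) k, A.rank = n ∧
        C = {Y | QForm.PointProjIso (QForm.hypersurfacePoints q A) Y}}.ncard = n + 1 := by
  subst hq
  have hscheme := QForm.existsUnique_and_ncard_classes (QForm.schemeProjIso_equivalence (k := k))
    (QForm.hypersurfaceIdeal (p ^ e)) (fun A => A.rank = n) (QForm.W k n) QForm.rank_W
    (fun A hA => (QForm.exists_qCongr_W p he A hA).imp fun s hs =>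
      (QForm.schemeProjIso_iff he _ _).mpr hs)
    (fun s s' h => QForm.eq_of_qCongr_W p e ((QForm.schemeProjIso_iff he _ _).mp h))
  have hpoint := QForm.existsUnique_and_ncard_classes (QForm.pointProjIso_equivalence (k := k))
    (QForm.hypersurfacePoints (p ^ e)) (fun A => A.rank = n) (QForm.W k n) QForm.rank_W
    (fun A hA => (QForm.exists_qCongr_W p he A hA).imp fun s hs => hs.pointProjIso)
    (fun s s' h => QForm.eq_of_pointProjIso_W he hn h)
  exact ⟨QForm.rank_W, fun A hA => ⟨hscheme.1 A hA, hpoint.1 A hA⟩, fun s s' hne =>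
    ⟨fun h => hne (QForm.eq_of_qCongr_W p e ((QForm.schemeProjIso_iff he _ _).mp h)),
      fun h => hne (QForm.eq_of_pointProjIso_W he hn h)⟩, hscheme.2, hpoint.2⟩
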